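/- \textbf{Setting (prophet secretary).} Let $X_1,\dots,X_n$ ($n\ge 1$) be independent non-negative random variables with continuous distributions, not necessarily identical, and let $t_1,\dots,t_n$ be arrival times uniform on $[0,1]$, all $2n$ variables being independent. The gambler sees the pairs $(t_i,X_i)$ in order of arrival and may irrevocably keep one value. Put $Z=\max_i X_i$. A strategy with reward $\mathsf{ALG}$ has competitive ratio at least $c$ if $\mathbb E[\mathsf{ALG}]\ge c\,\mathbb E[Z]$ for every such instance. \textbf{Strategy.} Let $m\ge 1$ and $\alpha_0=1>\alpha_1>\dots>\alpha_m>\alpha_{m+1}=0$. Choose thresholds $\tau_1,\dots,\tau_m$ with $\mathbb P(Z\le\tau_i)=\alpha_i$ (such thresholds exist, and necessarily $\tau_1>\dots>\tau_m\ge 0$), put $\tau(t)=\tau_{\lceil tm\rceil}$, and select the first arriving realization $(t_i,X_i)$ with $X_i\ge\tau(t_i)$; the reward $\mathsf{ALG}$ is its value, or $0$ if there is none. \textbf{Theorem.} (a) For all $m$ and $\alpha_1,\dots,\alpha_m$ as above, this strategy has competitive ratio at least \[ \min_{1\le j\le m+1}\ \inf_{\alpha_j\le\eta\le\alpha_{j-1},\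 \eta\ne 1}\ \frac{f_j(\alpha_1,\dots,\alpha_m,\eta)}{1-\eta}, \] where, for fixed $j$ and $\eta$, \[ f_j(\alpha_1,\dots,\alpha_m,\eta)=\frac1m\sum_{k=1}^{j-1}(1-\alpha_k)+\sum_{k=j}^m\Bigl(\prod_{\nu=1}^{k-1}\alpha_\nu\Bigr)^{1/m}w_k\,q_{\eta,k},\qquad w_k=\sum_{\nu=0}^{j-1}\frac{e^{-s_\nu}(1-e^{-r_\nu})}{m-(k-1)+\nu}, \] \[ r_\nu=\frac{m-(k-1)+\nu}{m}\log\frac{\hat\alpha_\nu}{\hat\alpha_{\nu+1}},\qquad s_\nu=\sum_{\beta=0}^{\nu-1}r_\beta,\qquad \hat\alpha_\nu=\alpha_\nu\ (\nu\le j-1),\quad \hat\alpha_j=\eta, \] \[ q_{\eta,k}=\sum_{\beta=0}^\infty e^{-x}\frac{x^\beta}{\beta!}\,\frac1{\beta+1},\qquad x=\frac1m\log\frac{\eta}{\alpha_k}; \] moreover $q_{\eta,k}=\dfrac{1-(\alpha_k/\eta)^{1/m}}{\frac1m\log(\eta/\alpha_k)}$ whenever $1\le k\le m$ and $\alpha_k<\eta\le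 1$. (b) Let $m=16$ and let $(\alpha_1,\dots,\alpha_{16})$ be $0.66758603836404173$, $0.62053145929311715$, $0.57324846512425975$, $0.52577742556626594$, $0.47816906417879007$, $0.43049233470891257$, $0.38283722646593055$, $0.33533950489086961$, $0.28831226925828957$, $0.23273108361807243$, $0.19315610994691487$, $0.16547915613363387$, $0.13558301500280728$, $0.10412501367635961$, $0.071479537771643828$, $0.036291830527618585$. These satisfy $1>\alpha_1>\dots>\alpha_{16}>0$, the lower bound in (a) is at least $0.6724$, and hence the corresponding strategy with $16$ thresholds has competitive ratio at least $0.6724$ for the prophet secretary problem. -/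

import Mathlib

open MeasureTheory ProbabilityTheory

noncomputable section

namespace ProphetSecretary

/-- An instance of the (non-IID) prophet secretary problem with times of arrival: independent,
non-negative values `X i` with continuous (atomless) distributions and arrival times `T i`,
uniform on `[0,1]`, where all the values and all the arrival times are mutually independent. -/
structure IsInstance {Ω : Type*} [MeasurableSpace Ω] (μ : Measure Ω) {n : ℕ}
    (X T : Fin n → Ω → ℝ) : Prop where
  measurable_value : ∀ i, Measurable (X i)
  measurable_time : ∀ i, Measurable (T i)
  value_nonneg : ∀ i, ∀ᵐ ω ∂μ, 0 ≤ X i ω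
  value_continuous : ∀ i x, μ {ω | X i ω = x} = 0
  time_uniform : ∀ i, μ.map (T i) = volume.restrict (Set.Icc (0 : ℝ) 1)
  indep : iIndepFun (Sum.elim X T) μ

/-- The prophet's value `Z = max_i X_i` (a maximum over the non-empty finite set `Fin n`
whenever `0 < n`). -/
def prophet {Ω : Type*} {n : ℕ} (X : Fin n → Ω → ℝ) (ω : Ω) : ℝ := ⨆ i, X i ω

/-- The step threshold function `τ(t) = τ_{⌈t m⌉}` built from `τ_1, …, τ_m`
(with `τ(0) = τ_1`; time `0` has probability zero). -/
def stepThreshold (m : ℕ) (τ : ℕ → ℝ) (t : ℝ) : ℝ := τ (max 1 ⌈t * m⌉₊)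

/-- The `i`-th realization passes the threshold at its own time of arrival. -/
def Passes {Ω : Type*} {n : ℕ} (m : ℕ) (τ : ℕ → ℝ) (X T : Fin n → Ω → ℝ) (ω : Ω)
    (i : Fin n) : Prop :=
  stepThreshold m τ (T i ω) ≤ X i ω

/-- The `i`-th realization is the one that is selected: it passes, and it is the first to arrive
among those that pass (simultaneous arrivals, an event of probability zero, are ordered by
index). -/
def Selected {Ω : Type*} {n : ℕ} (m : ℕ) (τ : ℕ → ℝ) (X T : Fin n → Ω → ℝ) (ω : Ω)
    (i : Fin n) : Prop :=
  Passes m τ X T ω i ∧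
    ∀ j, Passes m τ X T ω j → T i ω < T j ω ∨ (T i ω = T j ω ∧ i ≤ j)

open Classical in
/-- The reward of the strategy: the selected value, and `0` if nothing is selected.
At most one `i` is selected. -/
def reward {Ω : Type*} {n : ℕ} (m : ℕ) (τ : ℕ → ℝ) (X T : Fin n → Ω → ℝ) (ω : Ω) : ℝ :=
  ∑ i, if Selected m τ X T ω i then X i ω else 0

/-- `α_0 = 1 > α_1 > … > α_m > α_{m+1} = 0`. -/
def Admissible (m : ℕ) (α : ℕ → ℝ) : Prop :=
  α 0 = 1 ∧ α (m + 1) = 0 ∧ ∀ i ≤ m, α (i + 1) < α i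

/-- `τ_1, …, τ_m` are the `α_1, …, α_m` quantiles of the maximum: `P(Z ≤ τ_i) = α_i`. -/
def IsQuantiles {Ω : Type*} [MeasurableSpace Ω] (μ : Measure Ω) {n : ℕ} (X : Fin n → Ω → ℝ)
    (m : ℕ) (α τ : ℕ → ℝ) : Prop :=
  ∀ i ∈ Set.Icc 1 m, μ.real {ω | prophet X ω ≤ τ i} = α i

/-- The blind strategy with quantiles `α_1, …, α_m` has competitive ratio at least `c`:
`c * E[Z] ≤ E[ALG]` on every instance. Expectations of these non-negative variables are taken
in `[0, ∞]`, so that no integrability is presupposed. -/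
def IsCompetitive.{u} (m : ℕ) (α : ℕ → ℝ) (c : ℝ) : Prop :=
  ∀ (n : ℕ), 0 < n → ∀ (Ω : Type u) [MeasurableSpace Ω] (μ : Measure Ω)
    [IsProbabilityMeasure μ] (X T : Fin n → Ω → ℝ), IsInstance μ X T →
    ∀ τ : ℕ → ℝ, IsQuantiles μ X m α τ →
      ENNReal.ofReal c * ∫⁻ ω, ENNReal.ofReal (prophet X ω) ∂μ ≤
        ∫⁻ ω, ENNReal.ofReal (reward m τ X T ω) ∂μ

/-- `α̂_ν = α_ν` for `ν ≤ j - 1`, and `α̂_j = η`. -/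
def alphaHat (α : ℕ → ℝ) (j : ℕ) (η : ℝ) (ν : ℕ) : ℝ := if ν < j then α ν else η

/-- `r_ν = (m - (k - 1) + ν) / m * log (α̂_ν / α̂_{ν+1})`. -/
def r (m : ℕ) (α : ℕ → ℝ) (j : ℕ) (η : ℝ) (k ν : ℕ) : ℝ :=
  ((m : ℝ) - ((k : ℝ) - 1) + ν) / m *
    Real.log (alphaHat α j η ν / alphaHat α j η (ν + 1))

/-- `s_ν = ∑_{β=0}^{ν-1} r_β`. -/
def s (m : ℕ) (α : ℕ → ℝ) (j : ℕ) (η : ℝ) (k ν : ℕ) : ℝ :=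
  ∑ β ∈ Finset.range ν, r m α j η k β

/-- `w_k = ∑_{ν=0}^{j-1} e^{-s_ν} (1 - e^{-r_ν}) / (m - (k - 1) + ν)`. -/
def w (m : ℕ) (α : ℕ → ℝ) (j : ℕ) (η : ℝ) (k : ℕ) : ℝ :=
  ∑ ν ∈ Finset.range j, Real.exp (-s m α j η k ν) * (1 - Real.exp (-r m α j η k ν)) *
    (1 / ((m : ℝ) - ((k : ℝ) - 1) + ν))

/-- `q_{η,k} = ∑_{β≥0} e^{-x} x^β / β! / (β + 1)` with `x = (1/m) log (η / α_k)`. -/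
def q (m : ℕ) (α : ℕ → ℝ) (η : ℝ) (k : ℕ) : ℝ :=
  ∑' β : ℕ, Real.exp (-(1 / (m : ℝ) * Real.log (η / α k))) *
    (1 / (m : ℝ) * Real.log (η / α k)) ^ β * (1 / (β.factorial : ℝ)) * (1 / ((β : ℝ) + 1))

/-- `f_j(α, η) = (1/m) ∑_{k=1}^{j-1} (1 - α_k)
  + ∑_{k=j}^m (∏_{ν=1}^{k-1} α_ν)^{1/m} w_k q_{η,k}`. -/
def f (m : ℕ) (α : ℕ → ℝ) (j : ℕ) (η : ℝ) : ℝ :=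
  1 / (m : ℝ) * ∑ k ∈ Finset.Ico 1 j, (1 - α k) +
    ∑ k ∈ Finset.Icc j m,
      (∏ ν ∈ Finset.Ico 1 k, α ν) ^ (1 / (m : ℝ)) * w m α j η k * q m α η k

/-- The bound `min_{1 ≤ j ≤ m+1} min_{α_j ≤ η ≤ α_{j-1}} f_j(α, η) / (1 - η)`, as an infimum.
The single point `η = 1` (for `j = 1`), where the quotient reads `0 / 0`, is left out. -/
def ratioBound (m : ℕ) (α : ℕ → ℝ) : ℝ :=
  sInf {x | ∃ j ∈ Set.Icc 1 (m + 1), ∃ η ∈ Set.Icc (α j) (α (j - 1)),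
    η ≠ 1 ∧ x = f m α j η / (1 - η)}

/-- The explicit values `α_0 = 1, α_1, …, α_16, α_17 = 0`. -/
def alpha16 (i : ℕ) : ℝ :=
  [1, 0.66758603836404173, 0.62053145929311715, 0.57324846512425975,
    0.52577742556626594, 0.47816906417879007, 0.43049233470891257,
    0.38283722646593055, 0.33533950489086961, 0.28831226925828957,
    0.23273108361807243, 0.19315610994691487, 0.16547915613363387,
    0.13558301500280728, 0.10412501367635961, 0.071479537771643828,
    0.036291830527618585, 0].getD i 0

end ProphetSecretary

end

universe u

/-! Expectations are compared through tails: `E[ALG] = ∫ P(ALG > x) dx`, and likewise for `Z`. Fix a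
level `x`, put `η = P(Z ≤ x)` and let `j` be the index with `τ_j ≤ x < τ_{j-1}`. It suffices that
`P(ALG > x) ≥ f_j(η)`, because `P(Z > x) = 1 - η` and `α_j ≤ η ≤ α_{j-1}`.

An acceptance before slot `j` beats a threshold above `x`, so it yields a reward above `x`. By
independence and Chebyshev's sum inequality (`prod_one_sub_le`), this happens with probability at
least `(1/m) ∑_{k<j} (1 - α_k)`.

For a slot `k ≥ j` the thresholds above `x` and `x` itself cut out nested levels. The event that
some value exceeds `x` is split by the first level `p + 1` that not all values belong to, and by the
least index `i` of a value outside it. This `i` is tagged. If it arrives in slot `k` and no other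
variable stands in its way, the reward exceeds `x`. These events are disjoint from each other and
from early acceptance.

Given the arrival time of `i`, the other variables act independently. Each survival probability is
an affine expression in distribution functions, and weighted AM–GM (`exp_le_survival`) bounds it
below by a product of powers of them. Multiplied over all variables, these powers collapse to powers
of `α_ν` and `η`, so the particular instance disappears. Concavity of `y ↦ y ^ c`
(`mul_rpow_sub_rpow_le`) lets the tagged variable supply the factor it lacks, and the sum over `i`
telescopes (`sum_sub_mul_prod_ordered`). Integrating over the slot produces `q`; summing over levels
produces `w`.

For the 16 explicit quantiles, Bernoulli's inequality handles `j = 1`, and for `j = 17` the early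
term alone is enough. For the other `j`, `f_j` is bounded below by an affine function of `η`, so
only the two endpoints matter. All this reduces to rational arithmetic with enclosures of 16th roots
and their logarithms. -/

noncomputable section

namespace ProphetSecretary

/-! ### Independence of the value-time pairs, and conditioning on one of them -/

section Independence

variable {Ω : Type*} [MeasurableSpace Ω] {μ : Measure Ω} {n : ℕ} {X T : Fin n → Ω → ℝ}

theorem IsInstance.measurable_pair (h : IsInstance μ X T) (i : Fin n) :
    Measurable (fun ω => (X i ω, T i ω)) :=
  (h.measurable_value i).prodMk (h.measurable_time i)

variable [IsProbabilityMeasure μ]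

/-- The pairs `(X i, T i)` of an instance are independent over `i`. -/
theorem IsInstance.iIndepFun_pair (h : IsInstance μ X T) :
    iIndepFun (fun i ω => (X i ω, T i ω)) μ := by
  have hm : ∀ s, Measurable (Sum.elim X T s) := by
    rintro (i | i)
    · exact h.measurable_value i
    · exact h.measurable_time i
  have hpX : ∀ i, IsProbabilityMeasure (μ.map (X i)) := fun i =>
    Measure.isProbabilityMeasure_map (h.measurable_value i).aemeasurable
  have hpT : ∀ i, IsProbabilityMeasure (μ.map (T i)) := fun i =>
    Measure.isProbabilityMeasure_map (h.measurable_time i).aemeasurable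
  have hps : ∀ s, IsProbabilityMeasure (μ.map (Sum.elim X T s)) := fun s =>
    Measure.isProbabilityMeasure_map (hm s).aemeasurable
  have hjoint := h.indep.map_fun_eq_pi_map (fun s => (hm s).aemeasurable)
  have hpair : ∀ i, μ.map (fun ω => (X i ω, T i ω)) = (μ.map (X i)).prod (μ.map (T i)) := by
    intro i
    have := h.indep.indepFun (i := Sum.inl i) (j := Sum.inr i) (by simp)
    exact this.map_prod_eq_prod_map_map (h.measurable_value i).aemeasurable
      (h.measurable_time i).aemeasurable
  rw [iIndepFun_iff_map_fun_eq_pi_map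
    (fun i => ((h.measurable_value i).prodMk (h.measurable_time i)).aemeasurable)]
  simp_rw [hpair]
  -- The product law of all `2n` variables is carried to the law of `n` pairs by two
  -- measure-preserving rearrangements: first into a value vector and a time vector, then into a
  -- vector of pairs.
  have e1 := measurePreserving_sumPiEquivProdPi (fun s => μ.map (Sum.elim X T s))
  have e2 := (MeasurePreserving.symm _ (measurePreserving_arrowProdEquivProdArrow ℝ ℝ (Fin n)
    (fun i => μ.map (X i)) (fun i => μ.map (T i))))
  rw [← e2.map_eq]
  have e3 := e1.map_eq
  simp only [Sum.elim_inl, Sum.elim_inr] at e3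
  rw [← e3, ← hjoint, Measure.map_map e1.measurable (measurable_pi_lambda _ hm),
    Measure.map_map e2.measurable (e1.measurable.comp (measurable_pi_lambda _ hm))]
  rfl

theorem IsInstance.map_pair (h : IsInstance μ X T) (i : Fin n) :
    μ.map (fun ω => (X i ω, T i ω)) =
      (μ.map (X i)).prod (volume.restrict (Set.Icc (0 : ℝ) 1)) := by
  rw [← h.time_uniform i]
  have := h.indep.indepFun (i := Sum.inl i) (j := Sum.inr i) (by simp)
  exact this.map_prod_eq_prod_map_map (h.measurable_value i).aemeasurable
    (h.measurable_time i).aemeasurable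

/-- The law of a pair `(X i, T i)` evaluated on a rectangle. -/
theorem IsInstance.measure_rect (h : IsInstance μ X T) (i : Fin n) {A B : Set ℝ}
    (hA : MeasurableSet A) (hB : MeasurableSet B) :
    μ {ω | X i ω ∈ A ∧ T i ω ∈ B} = μ {ω | X i ω ∈ A} * volume (B ∩ Set.Icc 0 1) := by
  have h1 := congrArg (fun ν => ν (A ×ˢ B)) (h.map_pair i)
  beta_reduce at h1
  rw [Measure.map_apply (h.measurable_pair i) (hA.prod hB), Measure.prod_prod,
    Measure.map_apply (h.measurable_value i) hA, Measure.restrict_apply hB] at h1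
  exact h1

end Independence

/-- Conditioning one member of an independent family: the probability that `Y i` lies in `R` and
that all the other members satisfy constraints depending on `Y i`. -/
theorem measure_and_forall_ne_eq_setLIntegral {Ω β : Type*} [MeasurableSpace Ω]
    [MeasurableSpace β] {μ : Measure Ω} [IsProbabilityMeasure μ] {n : ℕ} {Y : Fin n → Ω → β}
    (hY : ∀ i, Measurable (Y i)) (hind : iIndepFun Y μ) (i : Fin n) {R : Set β}
    (hR : MeasurableSet R) {S : Fin n → Set (β × β)} (hS : ∀ l, MeasurableSet (S l)) :
    μ {ω | Y i ω ∈ R ∧ ∀ l ≠ i, (Y i ω, Y l ω) ∈ S l} =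
      ∫⁻ y in R, ∏ l ∈ Finset.univ.erase i, μ {ω | (y, Y l ω) ∈ S l} ∂(μ.map (Y i)) := by
  classical
  set W : Ω → ({l // l ∈ Finset.univ.erase i} → β) := fun ω l => Y l ω with hW
  have hWm : Measurable W := measurable_pi_lambda _ fun l => hY l
  have hiW : IndepFun (Y i) W μ := by
    have h1 := hind.indepFun_finset {i} (Finset.univ.erase i) (by simp) hY
    exact h1.comp (measurable_pi_apply (⟨i, by simp⟩ : ({i} : Finset (Fin n)))) measurable_id
  have hmap := hiW.map_prod_eq_prod_map_map (hY i).aemeasurable hWm.aemeasurable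
  set E : Set (β × ({l // l ∈ Finset.univ.erase i} → β)) :=
    (R ×ˢ Set.univ) ∩ ⋂ l : {l // l ∈ Finset.univ.erase i}, {z | (z.1, z.2 l) ∈ S l}
    with hE
  have hEm : MeasurableSet E := by
    refine (hR.prod MeasurableSet.univ).inter (MeasurableSet.iInter fun l => ?_)
    exact (measurable_fst.prodMk ((measurable_pi_apply l).comp measurable_snd)) (hS l)
  have hset : {ω | Y i ω ∈ R ∧ ∀ l ≠ i, (Y i ω, Y l ω) ∈ S l} =
      (fun ω => (Y i ω, W ω)) ⁻¹' E := by
    ext ω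
    simp [hE, hW]
  have hpW : IsProbabilityMeasure (μ.map W) := Measure.isProbabilityMeasure_map hWm.aemeasurable
  rw [hset, ← Measure.map_apply ((hY i).prodMk hWm) hEm, hmap, Measure.prod_apply hEm,
    ← lintegral_indicator hR]
  refine lintegral_congr fun y => ?_
  by_cases hy : y ∈ R
  · rw [Set.indicator_of_mem hy]
    rw [Measure.map_apply hWm (measurable_prodMk_left hEm)]
    have h2 : W ⁻¹' (Prod.mk y ⁻¹' E) =
        ⋂ l ∈ Finset.univ.erase i, Y l ⁻¹' {z | (y, z) ∈ S l} := by
      ext ω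
      simp [hE, hW, hy]
    rw [h2, hind.measure_inter_preimage_eq_mul _ (sets := fun l => {z | (y, z) ∈ S l})
      (fun l _ => measurable_prodMk_left (hS l))]
    rfl
  · rw [Set.indicator_of_notMem hy]
    have : Prod.mk y ⁻¹' E = ∅ := by
      ext z
      simp [hE, hy]
    simp [this]

/-! ### The Poisson mean of `1 / (N + 1)` -/

/-- `∑_{β ≥ 0} e^{-x} x^β / β! / (β + 1)`, the mean of `1 / (N + 1)` for `N` Poisson of
parameter `x`. -/
def poissonInv (x : ℝ) : ℝ :=
  ∑' β : ℕ, Real.exp (-x) * x ^ β * (1 / (β.factorial : ℝ)) * (1 / ((β : ℝ) + 1))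

theorem q_eq_poissonInv (m : ℕ) (α : ℕ → ℝ) (η : ℝ) (k : ℕ) :
    q m α η k = poissonInv (1 / (m : ℝ) * Real.log (η / α k)) := rfl

theorem poissonInv_zero : poissonInv 0 = 1 := by
  unfold poissonInv
  rw [tsum_eq_single 0]
  · simp
  · intro b hb
    simp [hb]

theorem poissonInv_of_ne_zero {x : ℝ} (hx : x ≠ 0) :
    poissonInv x = (1 - Real.exp (-x)) / x := by
  have h1 : HasSum (fun β : ℕ => x ^ β / (β.factorial : ℝ)) (Real.exp x) := by
    rw [Real.exp_eq_exp_ℝ]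
    exact NormedSpace.expSeries_div_hasSum_exp x
  have h2 := (hasSum_nat_add_iff' 1).2 h1
  have h3 := h2.mul_left (Real.exp (-x) / x)
  unfold poissonInv
  rw [show (1 - Real.exp (-x)) / x =
    Real.exp (-x) / x * (Real.exp x - ∑ i ∈ Finset.range 1, x ^ i / (i.factorial : ℝ)) by
      have : Real.exp (-x) * Real.exp x = 1 := by rw [← Real.exp_add]; simp
      simp only [Finset.range_one, Finset.sum_singleton, pow_zero, Nat.factorial_zero,
        Nat.cast_one, div_one]
      field_simp
      linear_combination -this]
  rw [← h3.tsum_eq]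
  refine tsum_congr fun β => ?_
  rw [Nat.factorial_succ]
  push_cast
  have : ((β : ℝ) + 1) ≠ 0 := by positivity
  have : (β.factorial : ℝ) ≠ 0 := by positivity
  field_simp
  ring

/-- Here `v` plays the part of the elapsed fraction of a time slot: averaging an exponential
survival factor over the slot gives this mean. Positivity, monotonicity and the numerical bounds are
all read off the integrand. -/
theorem poissonInv_eq_integral (x : ℝ) :
    poissonInv x = ∫ v in (0 : ℝ)..1, Real.exp (-(x * v)) := by
  rcases eq_or_ne x 0 with rfl | hx
  · simp [poissonInv_zero]
  · rw [poissonInv_of_ne_zero hx]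
    have h : ∀ v ∈ Set.uIcc (0 : ℝ) 1,
        HasDerivAt (fun v => -(Real.exp (-(x * v)) / x)) (Real.exp (-(x * v))) v := by
      intro v _
      have h1 : HasDerivAt (fun v : ℝ => -(x * v)) (-x) v := by
        have := ((hasDerivAt_id v).const_mul x).fun_neg
        simpa only [id, mul_one] using this
      have h2 := (h1.exp.div_const x).fun_neg
      rwa [mul_neg, neg_div, neg_neg, mul_div_cancel_right₀ _ hx] at h2
    rw [intervalIntegral.integral_eq_sub_of_hasDerivAt h
      (Continuous.intervalIntegrable (by fun_prop) _ _)]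
    simp
    field_simp
    ring

theorem poissonInv_nonneg (x : ℝ) : 0 ≤ poissonInv x := by
  rw [poissonInv_eq_integral]
  exact intervalIntegral.integral_nonneg (by norm_num) fun v _ => (Real.exp_pos _).le

theorem poissonInv_antitone : Antitone poissonInv := by
  intro x y hxy
  rw [poissonInv_eq_integral, poissonInv_eq_integral]
  refine intervalIntegral.integral_mono_on (by norm_num)
    (Continuous.intervalIntegrable (by fun_prop) _ _)
    (Continuous.intervalIntegrable (by fun_prop) _ _) fun v hv => ?_
  have := mul_le_mul_of_nonneg_right hxy hv.1
  exact Real.exp_le_exp.2 (by linarith)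

/-- Since `v ≤ 1`, the integrand drops by at most the factor `e^{-(y - x)}`. This later controls how
fast `q` falls as `η` grows. -/
theorem exp_neg_mul_poissonInv_le {x y : ℝ} (hxy : x ≤ y) :
    Real.exp (-(y - x)) * poissonInv x ≤ poissonInv y := by
  rw [poissonInv_eq_integral, poissonInv_eq_integral, ← intervalIntegral.integral_const_mul]
  refine intervalIntegral.integral_mono_on (by norm_num)
    (Continuous.intervalIntegrable (by fun_prop) _ _)
    (Continuous.intervalIntegrable (by fun_prop) _ _) fun v hv => ?_
  rw [← Real.exp_add]
  have := mul_le_mul_of_nonneg_left hv.2 (sub_nonneg.2 hxy)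
  exact Real.exp_le_exp.2 (by linarith)

theorem poissonInv_le_one {x : ℝ} (hx : 0 ≤ x) : poissonInv x ≤ 1 := by
  rw [← poissonInv_zero]
  exact poissonInv_antitone hx

/-- The exponential survival factor integrated over one time slot. -/
theorem setLIntegral_exp_slot (a y δ : ℝ) (hδ : 0 < δ) :
    ∫⁻ t in Set.Ioc a (a + δ), ENNReal.ofReal (Real.exp (-(y * (t - a)))) =
      ENNReal.ofReal (δ * poissonInv (δ * y)) := by
  rw [← ofReal_integral_eq_lintegral_ofReal]
  · rw [← intervalIntegral.integral_of_le (by linarith), poissonInv_eq_integral]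
    congr 1
    have h := intervalIntegral.mul_integral_comp_mul_add
      (f := fun t => Real.exp (-(y * (t - a)))) (a := 0) (b := 1) δ a
    rw [show δ * 0 + a = a by ring, show δ * 1 + a = a + δ by ring] at h
    rw [← h]
    congr 1
    refine intervalIntegral.integral_congr fun v _ => ?_
    congr 1
    ring
  · have : Continuous fun t => Real.exp (-(y * (t - a))) := by fun_prop
    exact (this.integrableOn_Icc (a := a) (b := a + δ)).mono_set Set.Ioc_subset_Icc_self
  · exact Filter.Eventually.of_forall fun t => (Real.exp_pos _).le

/-! ### Elementary inequalities -/

/-- A weighted AM–GM inequality: the chance that a variable of the family stays acceptable is at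
least its Poissonized counterpart. -/
theorem exp_le_survival {m : ℕ} {I : Finset ℕ} {a : ℕ → ℝ} {u v b c s : ℝ}
    (ha : ∀ ν ∈ I, 0 < a ν) (hb : 0 < b) (hbv : b ≤ v) (hvu : v ≤ u) (hs : 0 ≤ s) (hsc : s ≤ c)
    (hc : c + I.card * (1 / (m : ℝ)) = 1) :
    Real.exp (c * Real.log u + (1 / (m : ℝ) * ∑ ν ∈ I, Real.log (a ν) +
        s * (Real.log b - Real.log v))) ≤
      u * c + 1 / (m : ℝ) * ∑ ν ∈ I, a ν - s * (v - b) := by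
  set E := c * Real.log u + (1 / (m : ℝ) * ∑ ν ∈ I, Real.log (a ν) +
        s * (Real.log b - Real.log v)) with hE
  have hv : 0 < v := hb.trans_le hbv
  have hu : 0 < u := hv.trans_le hvu
  -- Tangent line of `exp` at `E`, evaluated at `log z`. As `E` is the weighted mean of the
  -- logarithms and the weights sum to `1`, adding these estimates gives AM–GM.
  have key : ∀ z : ℝ, 0 < z → Real.exp E * (1 + Real.log z - E) ≤ z := by
    intro z hz
    have h1 := Real.add_one_le_exp (Real.log z - E)
    rw [Real.exp_sub, Real.exp_log hz, le_div_iff₀ (Real.exp_pos E)] at h1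
    linarith
  have k1 := mul_le_mul_of_nonneg_left (key u hu) (sub_nonneg.2 hsc)
  -- The weight `c` of `u` is split: `c - s` stays on `u`, and `s` moves to `u * b / v`, whose
  -- logarithm supplies `log b - log v`.
  have k2 := mul_le_mul_of_nonneg_left (key (u * b / v) (by positivity)) hs
  rw [Real.log_div (by positivity) hv.ne', Real.log_mul hu.ne' hb.ne'] at k2
  have k3 : ∑ ν ∈ I, Real.exp E * (1 + Real.log (a ν) - E) ≤ ∑ ν ∈ I, a ν :=
    Finset.sum_le_sum fun ν hν => key _ (ha ν hν)
  have k4 : ∑ ν ∈ I, Real.exp E * (1 + Real.log (a ν) - E) =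
      Real.exp E * (I.card * (1 - E) + ∑ ν ∈ I, Real.log (a ν)) := by
    rw [← Finset.mul_sum]
    congr 1
    rw [Finset.sum_sub_distrib, Finset.sum_add_distrib]
    simp
    ring
  rw [k4] at k3
  have k5 := mul_le_mul_of_nonneg_left k3 (by positivity : (0 : ℝ) ≤ 1 / (m : ℝ))
  -- This is `(u - v) * (v - b) ≥ 0`; it turns the quotient into the linear loss `v - b`.
  have k6 : s * (u * b / v) ≤ s * (u - v + b) := by
    refine mul_le_mul_of_nonneg_left ?_ hs
    rw [div_le_iff₀ hv]
    nlinarith [mul_nonneg (sub_nonneg.2 hvu) (sub_nonneg.2 hbv)]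
  have k7 : Real.exp E * ((c - s) * (1 + Real.log u - E) +
      s * (1 + (Real.log u + Real.log b - Real.log v) - E) +
      1 / (m : ℝ) * (I.card * (1 - E) + ∑ ν ∈ I, Real.log (a ν))) = Real.exp E := by
    have : (c - s) * (1 + Real.log u - E) +
      s * (1 + (Real.log u + Real.log b - Real.log v) - E) +
      1 / (m : ℝ) * (I.card * (1 - E) + ∑ ν ∈ I, Real.log (a ν)) = 1 := by
      linear_combination (1 - E) * hc - hE
    rw [this, mul_one]
  nlinarith [k1, k2, k5, k6, k7]

/-- Concavity of `y ↦ y ^ c` on `[b, a]`, in the form in which it bounds `a - b` from below. -/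
theorem mul_rpow_sub_rpow_le {a b c D : ℝ} (hb : 0 < b) (hba : b ≤ a) (hc : 0 < c) (hc1 : c ≤ 1)
    (hD : D ≤ b ^ (1 - c)) : D * (1 / c * (a ^ c - b ^ c)) ≤ a - b := by
  have ha : 0 < a := hb.trans_le hba
  -- Bernoulli's inequality for an exponent at most `1`.
  have h1 : (a / b) ^ c ≤ 1 + c * (a / b - 1) := by
    have := rpow_one_add_le_one_add_mul_self (s := a / b - 1) (p := c)
      (by have : 0 < a / b := by positivity
          linarith) hc.le hc1
    simpa using this
  rw [Real.div_rpow ha.le hb.le, div_le_iff₀ (Real.rpow_pos_of_pos hb c)] at h1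
  have h2 : b ^ (1 - c) * b ^ c = b := by
    rw [← Real.rpow_add hb]
    simp
  have h3 : 0 ≤ 1 / c * (a ^ c - b ^ c) :=
    mul_nonneg (by positivity) (sub_nonneg.2 (Real.rpow_le_rpow hb.le hba hc.le))
  calc D * (1 / c * (a ^ c - b ^ c)) ≤ b ^ (1 - c) * (1 / c * (a ^ c - b ^ c)) :=
        mul_le_mul_of_nonneg_right hD h3
    _ ≤ b ^ (1 - c) * (1 / c * (c * (a / b - 1) * b ^ c)) := by
        refine mul_le_mul_of_nonneg_left (mul_le_mul_of_nonneg_left ?_ (by positivity))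
          (Real.rpow_nonneg hb.le _)
        linarith
    _ = (b ^ (1 - c) * b ^ c) * (a / b - 1) := by field_simp
    _ = a - b := by
        rw [h2]
        field_simp

/-- Telescoping of a difference of products, ordered by index. -/
theorem sum_sub_mul_prod_ordered {n : ℕ} (A B : Fin n → ℝ) :
    ∑ i, (A i - B i) * ∏ l ∈ Finset.univ.erase i, (if l < i then B l else A l) =
      ∏ i, A i - ∏ i, B i := by
  have h := Finset.prod_add_ordered Finset.univ A (fun i => B i - A i)
  simp only [add_sub_cancel] at h
  rw [h]
  rw [sub_add_cancel_left, ← Finset.sum_neg_distrib]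
  refine Finset.sum_congr rfl fun i _ => ?_
  have hdisj : Disjoint (Finset.univ.filter fun l => l < i) (Finset.univ.filter fun l => i < l) :=
    Finset.disjoint_filter.2 fun l _ h1 h2 => lt_asymm h1 h2
  have hun : Finset.univ.erase i =
      (Finset.univ.filter fun l => l < i) ∪ (Finset.univ.filter fun l => i < l) := by
    ext l
    simp [lt_or_lt_iff_ne]
  rw [hun, Finset.prod_union hdisj,
    Finset.prod_congr rfl (g := B) (fun l hl => by simp [(Finset.mem_filter.1 hl).2]),
    Finset.prod_congr (s₁ := Finset.univ.filter fun l => i < l) rfl (g := A)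
      (fun l hl => by simp [(Finset.mem_filter.1 hl).2.not_gt])]
  ring

/-- Chebyshev: if something is accepted whenever the maximum is, the acceptance probability is
at least that of the maximum being accepted. -/
theorem prod_one_sub_le {ι : Type*} (I : Finset ι) (K : Finset ℕ) {m : ℕ} (hm : 0 < m)
    (hK : K.card ≤ m) (a : ι → ℕ → ℝ) (ha0 : ∀ l, ∀ k ∈ K, 0 ≤ a l k)
    (ha1 : ∀ l, ∀ k ∈ K, a l k ≤ 1) (hanti : ∀ l, AntitoneOn (a l) K) :
    ∏ l ∈ I, (1 - 1 / (m : ℝ) * ∑ k ∈ K, (1 - a l k)) ≤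
      1 - 1 / (m : ℝ) * ∑ k ∈ K, (1 - ∏ l ∈ I, a l k) := by
  classical
  have hm' : (0 : ℝ) < m := by exact_mod_cast hm
  induction I using Finset.induction_on with
  | empty => simp
  | insert i I hi ih =>
    rw [Finset.prod_insert hi]
    set y : ℕ → ℝ := fun k => ∏ l ∈ I, a l k with hy
    have hy1 : ∀ k ∈ K, y k ≤ 1 := fun k hk =>
      Finset.prod_le_one (fun l _ => ha0 l k hk) (fun l _ => ha1 l k hk)
    have hyanti : AntitoneOn y K := fun k hk k' hk' hkk' =>
      Finset.prod_le_prod (fun l _ => ha0 l k' hk') (fun l _ => hanti l hk hk' hkk')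
    have hfac : 0 ≤ 1 - 1 / (m : ℝ) * ∑ k ∈ K, (1 - a i k) := by
      have h1 : ∑ k ∈ K, (1 - a i k) ≤ ∑ k ∈ K, (1 : ℝ) :=
        Finset.sum_le_sum fun k hk => by linarith [ha0 i k hk]
      have h2 : (K.card : ℝ) ≤ m := by exact_mod_cast hK
      simp only [Finset.sum_const, nsmul_eq_mul, mul_one] at h1
      rw [sub_nonneg, one_div, inv_mul_le_iff₀ hm']
      linarith
    -- Both `1 - a i k` and `1 - y k` increase with `k`, so Chebyshev's sum inequality applies; the
    -- cardinality of `K` is then replaced by the larger `m`.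
    have hcheb : (∑ k ∈ K, (1 - a i k)) * ∑ k ∈ K, (1 - y k) ≤
        m * ∑ k ∈ K, (1 - a i k) * (1 - y k) := by
      have hmono : MonovaryOn (fun k => 1 - a i k) (fun k => 1 - y k) K := by
        intro k hk k' hk' hlt
        dsimp only at hlt ⊢
        have hkk : k ≤ k' := by
          by_contra hcon
          have := hyanti hk' hk (not_le.1 hcon).le
          linarith
        linarith [hanti i hk hk' hkk]
      refine hmono.sum_mul_sum_le_card_mul_sum.trans ?_
      refine mul_le_mul_of_nonneg_right (by exact_mod_cast hK) (Finset.sum_nonneg fun k hk => ?_)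
      exact mul_nonneg (by linarith [ha1 i k hk]) (by linarith [hy1 k hk])
    have hexp : ∑ k ∈ K, (1 - ∏ l ∈ insert i I, a l k) =
        ∑ k ∈ K, (1 - a i k) + ∑ k ∈ K, (1 - y k) - ∑ k ∈ K, (1 - a i k) * (1 - y k) := by
      rw [← Finset.sum_add_distrib, ← Finset.sum_sub_distrib]
      refine Finset.sum_congr rfl fun k _ => ?_
      rw [Finset.prod_insert hi]
      simp only [hy]
      ring
    have h3 := mul_le_mul_of_nonneg_left ih hfac
    refine h3.trans ?_
    rw [hexp]
    set P := ∑ k ∈ K, (1 - a i k)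
    set Q := ∑ k ∈ K, (1 - y k)
    set R := ∑ k ∈ K, (1 - a i k) * (1 - y k)
    have h4 : 1 / (m : ℝ) * P * (1 / (m : ℝ) * Q) ≤ 1 / (m : ℝ) * R := by
      have : 1 / (m : ℝ) * P * (1 / (m : ℝ) * Q) = 1 / (m : ℝ) * (1 / (m : ℝ)) * (P * Q) := by ring
      rw [this]
      calc _ ≤ 1 / (m : ℝ) * (1 / (m : ℝ)) * (m * R) :=
            mul_le_mul_of_nonneg_left hcheb (by positivity)
        _ = _ := by field_simp
    linarith

/-! ### Time slots -/

/-- The index of the time slot to which `t` belongs. -/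
def slot (m : ℕ) (t : ℝ) : ℕ := max 1 ⌈t * m⌉₊

theorem stepThreshold_eq (m : ℕ) (τ : ℕ → ℝ) (t : ℝ) : stepThreshold m τ t = τ (slot m t) := rfl

theorem one_le_slot (m : ℕ) (t : ℝ) : 1 ≤ slot m t := le_max_left _ _

theorem slot_mono (m : ℕ) : Monotone (slot m) := fun _ _ h =>
  max_le_max le_rfl (Nat.ceil_mono (mul_le_mul_of_nonneg_right h (Nat.cast_nonneg m)))

theorem measurable_slot (m : ℕ) : Measurable (slot m) :=
  measurable_const.max (Nat.measurable_ceil.comp (measurable_id.mul_const _))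

/-- The left end `(k - 1) / m` of the `k`-th time slot. -/
def slotStart (m k : ℕ) : ℝ := ((k : ℝ) - 1) / m

theorem slot_eq_of_mem_Ioc {m k : ℕ} (hm : 0 < m) (hk : 1 ≤ k) {t : ℝ}
    (ht : t ∈ Set.Ioc (slotStart m k) (slotStart m k + 1 / m)) : slot m t = k := by
  have hm' : (0 : ℝ) < m := by exact_mod_cast hm
  obtain ⟨h1, h2⟩ := ht
  unfold slotStart at h1 h2
  rw [← add_div, le_div_iff₀ hm'] at h2
  rw [div_lt_iff₀ hm'] at h1
  have : ⌈t * m⌉₊ = k := by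
    rw [Nat.ceil_eq_iff (by omega), Nat.cast_sub hk]
    push_cast
    constructor <;> linarith
  rw [slot, this]
  exact max_eq_right hk

/-- The interval is closed on the left because time `0` is assigned to slot `1`. -/
theorem mem_Icc_of_slot_eq {m k : ℕ} (hm : 0 < m) {t : ℝ} (ht : t ∈ Set.Icc (0 : ℝ) 1)
    (hk : slot m t = k) : t ∈ Set.Icc (slotStart m k) (slotStart m k + 1 / m) := by
  have hm' : (0 : ℝ) < m := by exact_mod_cast hm
  have h1 : t * m ≤ k := by
    have := Nat.le_ceil (t * m)
    have h2 : (⌈t * m⌉₊ : ℝ) ≤ k := by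
      rw [← hk]
      exact_mod_cast le_max_right _ _
    linarith
  have h3 : (k : ℝ) - 1 ≤ t * m := by
    have h4 := Nat.ceil_lt_add_one (mul_nonneg ht.1 hm'.le)
    rcases max_choice 1 ⌈t * m⌉₊ with h | h
    · have : k = 1 := by rw [← hk, slot, h]
      rw [this]
      have := mul_nonneg ht.1 hm'.le
      simpa using this
    · have : k = ⌈t * m⌉₊ := by rw [← hk, slot, h]
      rw [← this] at h4
      linarith
  unfold slotStart
  constructor
  · rwa [div_le_iff₀ hm']
  · rw [← add_div, le_div_iff₀ hm']
    linarith

theorem Ioc_slot_subset_Icc {m k : ℕ} (hm : 0 < m) (hk : 1 ≤ k) (hkm : k ≤ m) :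
    Set.Ioc (slotStart m k) (slotStart m k + 1 / m) ⊆ Set.Icc 0 1 := by
  have hm' : (0 : ℝ) < m := by exact_mod_cast hm
  have hk' : (1 : ℝ) ≤ k := by exact_mod_cast hk
  have hkm' : (k : ℝ) ≤ m := by exact_mod_cast hkm
  intro t ht
  unfold slotStart at ht
  have h1 : 0 ≤ ((k : ℝ) - 1) / m := div_nonneg (by linarith) hm'.le
  have h2 := ht.2
  rw [← add_div, le_div_iff₀ hm'] at h2
  exact ⟨by linarith [ht.1], by nlinarith⟩

/-! ### Survival probability of a single variable -/

section SingleVariable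

variable {Ω : Type*} [MeasurableSpace Ω] {μ : Measure Ω} {n : ℕ} {X T : Fin n → Ω → ℝ}

theorem IsInstance.ae_time_mem (h : IsInstance μ X T) (l : Fin n) :
    ∀ᵐ ω ∂μ, T l ω ∈ Set.Icc (0 : ℝ) 1 := by
  have h1 : ∀ᵐ t ∂(μ.map (T l)), t ∈ Set.Icc (0 : ℝ) 1 := by
    rw [h.time_uniform l]
    exact ae_restrict_mem measurableSet_Icc
  exact ae_of_ae_map (h.measurable_time l).aemeasurable h1

variable [IsProbabilityMeasure μ]

theorem IsInstance.real_rect_le (h : IsInstance μ X T) (l : Fin n) {A : Set ℝ}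
    (hA : MeasurableSet A) {a b : ℝ} (hab : a ≤ b) :
    μ.real {ω | X l ω ∈ A ∧ T l ω ∈ Set.Icc a b} ≤ μ.real {ω | X l ω ∈ A} * (b - a) := by
  unfold Measure.real
  rw [h.measure_rect l hA measurableSet_Icc, ENNReal.toReal_mul]
  refine mul_le_mul_of_nonneg_left ?_ ENNReal.toReal_nonneg
  have h1 : volume (Set.Icc a b ∩ Set.Icc 0 1) ≤ ENNReal.ofReal (b - a) := by
    rw [← Real.volume_Icc]
    exact measure_mono Set.inter_subset_left
  exact ENNReal.toReal_le_of_le_ofReal (by linarith) h1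

/-- A value-time pair that does not stand in the way of a value above `x` which arrives at time `t`
in the slot `k`: it is not accepted before that slot, and it is not accepted in that slot up to
time `t` with a value of at most `x`. -/
def okSet (m : ℕ) (τ : ℕ → ℝ) (x : ℝ) (k : ℕ) : Set (ℝ × (ℝ × ℝ)) :=
  {z | ¬ (slot m z.2.2 < k ∧ τ (slot m z.2.2) ≤ z.2.1) ∧
    ¬ (slot m z.2.2 = k ∧ z.2.2 ≤ z.1 ∧ τ k ≤ z.2.1 ∧ z.2.1 ≤ x)}

theorem measurableSet_okSet (m : ℕ) (τ : ℕ → ℝ) (x : ℝ) (k : ℕ) :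
    MeasurableSet (okSet m τ x k) := by
  have h1 : Measurable fun z : ℝ × (ℝ × ℝ) => slot m z.2.2 :=
    (measurable_slot m).comp (measurable_snd.comp measurable_snd)
  have h2 : Measurable fun z : ℝ × (ℝ × ℝ) => τ (slot m z.2.2) :=
    (measurable_from_top (f := τ)).comp h1
  have h3 : Measurable fun z : ℝ × (ℝ × ℝ) => z.2.1 := measurable_fst.comp measurable_snd
  have h4 : Measurable fun z : ℝ × (ℝ × ℝ) => z.2.2 := measurable_snd.comp measurable_snd
  refine MeasurableSet.inter (MeasurableSet.compl ?_) (MeasurableSet.compl ?_)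
  · exact (measurableSet_lt h1 measurable_const).inter (measurableSet_le h2 h3)
  · exact (measurableSet_eq_fun h1 measurable_const).inter
      ((measurableSet_le h4 measurable_fst).inter
        ((measurableSet_le measurable_const h3).inter (measurableSet_le h3 measurable_const)))

/-- Lower bound for the probability that one variable of the family lies in `U` without standing
in the way. -/
theorem IsInstance.survival_le_real (h : IsInstance μ X T) (l : Fin n) {m p k : ℕ} (hm : 0 < m)
    (hpk : p < k) {τ : ℕ → ℝ} {x t : ℝ} {U : Set ℝ} (hU : MeasurableSet U)
    (htop : ∀ ν, 1 ≤ ν → ν ≤ p → U ⊆ Set.Iic (τ ν))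
    (hbot : ∀ ν, p < ν → ν < k → Set.Iic (τ ν) ⊆ U)
    (hx : τ k ≤ x) (ht : slotStart m k ≤ t) :
    μ.real {ω | X l ω ∈ U} * (((m : ℝ) - (k - 1) + p) / m) +
        1 / (m : ℝ) * ∑ ν ∈ Finset.Ioo p k, μ.real {ω | X l ω ≤ τ ν} -
        (t - slotStart m k) * (μ.real {ω | X l ω ≤ x} - μ.real {ω | X l ω ≤ τ k}) ≤
      μ.real {ω | X l ω ∈ U ∧ (t, (X l ω, T l ω)) ∈ okSet m τ x k} := by
  have hm' : (0 : ℝ) < m := by exact_mod_cast hm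
  set u := μ.real {ω | X l ω ∈ U} with hu
  have hXm := h.measurable_value l
  have diff : ∀ (V : Set ℝ) (y : ℝ), MeasurableSet V → Set.Iic y ⊆ V →
      μ.real {ω | X l ω ∈ V \ Set.Iio y} = μ.real {ω | X l ω ∈ V} - μ.real {ω | X l ω ≤ y} := by
    intro V y hV hyV
    -- The law has no atoms, so closed and open half-lines have the same mass.
    have h1 : μ.real {ω | X l ω ≤ y} = μ.real {ω | X l ω < y} := by
      refine measureReal_congr ?_
      filter_upwards [measure_eq_zero_iff_ae_notMem.1 (h.value_continuous l y)] with ω hω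
      refine propext ⟨fun h1 => lt_of_le_of_ne h1 hω, fun h1 => le_of_lt h1⟩
    rw [h1]
    exact measureReal_sdiff (μ := μ) (s₁ := {ω | X l ω ∈ V}) (s₂ := {ω | X l ω < y})
      (fun ω hω => hyV (Set.mem_Iic.2 (le_of_lt (show X l ω < y from hω)))) (hXm measurableSet_Iio)
  set A := {ω | X l ω ∈ U ∧ (t, (X l ω, T l ω)) ∈ okSet m τ x k}
  set B := ⋃ ν ∈ Finset.Ioo p k,
    {ω | X l ω ∈ U \ Set.Iio (τ ν) ∧ T l ω ∈ Set.Icc (slotStart m ν) (slotStart m ν + 1 / m)}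
  set C := {ω | X l ω ∈ Set.Iic x \ Set.Iio (τ k) ∧ T l ω ∈ Set.Icc (slotStart m k) t}
  -- A variable in `U` either survives (`A`), or is accepted in an earlier slot (`B`), or is
  -- accepted in slot `k` by time `t` with value at most `x` (`C`). Bounding `B` and `C` above
  -- bounds `A` below.
  have hsub : {ω | X l ω ∈ U} ≤ᵐ[μ] (A ∪ (B ∪ C) : Set Ω) := by
    have hne : ∀ᵐ ω ∂μ, ∀ ν, X l ω ≠ τ ν := by
      rw [ae_all_iff]
      exact fun ν => measure_eq_zero_iff_ae_notMem.1 (h.value_continuous l (τ ν))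
    filter_upwards [h.ae_time_mem l, hne] with ω hT hν hωU
    change ω ∈ A ∪ (B ∪ C)
    have hωU' : X l ω ∈ U := hωU
    by_cases hok : (t, (X l ω, T l ω)) ∈ okSet m τ x k
    · exact Or.inl ⟨hωU, hok⟩
    right
    rw [okSet, Set.mem_ofPred_eq, not_and_or, not_not, not_not] at hok
    rcases hok with ⟨h1, h2⟩ | ⟨h1, h2, h3, h4⟩
    · left
      dsimp only at h1 h2
      -- In slots up to `p`, a value in `U` lies at or below the threshold; being accepted there
      -- would force equality, a null event.
      have hp : p < slot m (T l ω) := by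
        by_contra hcon
        have h5 := htop _ (one_le_slot m (T l ω)) (not_lt.1 hcon) hωU'
        exact hν _ (le_antisymm h5 h2)
      refine Set.mem_biUnion (x := slot m (T l ω)) (by simp [hp, h1]) ?_
      exact ⟨⟨hωU', not_lt.2 h2⟩, mem_Icc_of_slot_eq hm hT rfl⟩
    · right
      exact ⟨⟨h4, not_lt.2 h3⟩, (mem_Icc_of_slot_eq hm hT h1).1, h2⟩
  have e1 : u ≤ μ.real (A ∪ (B ∪ C)) :=
    ENNReal.toReal_mono (measure_ne_top _ _) (measure_mono_ae hsub)
  have e2 : μ.real (A ∪ (B ∪ C)) ≤ μ.real A + (μ.real B + μ.real C) :=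
    (measureReal_union_le _ _).trans (add_le_add le_rfl (measureReal_union_le _ _))
  have e3 : μ.real B ≤ ∑ ν ∈ Finset.Ioo p k, (u - μ.real {ω | X l ω ≤ τ ν}) * (1 / (m : ℝ)) := by
    refine (measureReal_biUnion_finset_le _ _).trans (Finset.sum_le_sum fun ν hν => ?_)
    rw [Finset.mem_Ioo] at hν
    have := h.real_rect_le l (hU.diff measurableSet_Iio) (A := U \ Set.Iio (τ ν))
      (a := slotStart m ν) (b := slotStart m ν + 1 / m)
      (by have : (0 : ℝ) ≤ 1 / m := by positivity
          linarith)
    rwa [diff U (τ ν) hU (hbot ν hν.1 hν.2), add_sub_cancel_left] at this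
  have e4 : μ.real C ≤ (μ.real {ω | X l ω ≤ x} - μ.real {ω | X l ω ≤ τ k}) *
      (t - slotStart m k) := by
    have := h.real_rect_le l (measurableSet_Iic.diff measurableSet_Iio)
      (A := Set.Iic x \ Set.Iio (τ k)) ht
    rwa [diff (Set.Iic x) (τ k) measurableSet_Iic (Set.Iic_subset_Iic.2 hx)] at this
  -- The `k - 1 - p` slots strictly between `p` and `k` each cost `u / m`, which lowers the
  -- coefficient of `u` from `1` to `(m - (k - 1) + p) / m`.
  have e5 : ∑ ν ∈ Finset.Ioo p k, (u - μ.real {ω | X l ω ≤ τ ν}) * (1 / (m : ℝ)) =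
      u * ((k : ℝ) - 1 - p) / m - 1 / (m : ℝ) * ∑ ν ∈ Finset.Ioo p k, μ.real {ω | X l ω ≤ τ ν} := by
    rw [← Finset.sum_mul, Finset.sum_sub_distrib, Finset.sum_const, Nat.card_Ioo, nsmul_eq_mul,
      Nat.cast_sub (by omega), Nat.cast_sub (by omega)]
    push_cast
    ring
  have e6 : u * (((m : ℝ) - (k - 1) + p) / m) = u - u * ((k : ℝ) - 1 - p) / m := by
    field_simp
    ring
  rw [e6]
  linarith

end SingleVariable

/-- The contribution of the tagged variable `i`, with all the time-dependent factors collected. -/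
theorem tagged_product_le {n : ℕ} (i : Fin n) {a b d : Fin n → ℝ} {c : ℝ} (hc : 0 < c)
    (hc1 : c ≤ 1) (hb : ∀ l, 0 < b l) (hba : ∀ l, b l ≤ a l)
    (hd : d i ≤ (1 - c) * Real.log (b i)) :
    1 / c * ((a i ^ c - b i ^ c) *
        ∏ l ∈ Finset.univ.erase i, (if l < i then b l ^ c else a l ^ c)) * Real.exp (∑ l, d l) ≤
      (a i - b i) * ∏ l ∈ Finset.univ.erase i,
        Real.exp (c * Real.log (if l < i then b l else a l) + d l) := by
  have ha : ∀ l, 0 < a l := fun l => (hb l).trans_le (hba l)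
  have h1 : ∏ l ∈ Finset.univ.erase i,
        Real.exp (c * Real.log (if l < i then b l else a l) + d l) =
      (∏ l ∈ Finset.univ.erase i, (if l < i then b l ^ c else a l ^ c)) *
        Real.exp (∑ l ∈ Finset.univ.erase i, d l) := by
    rw [Real.exp_sum, ← Finset.prod_mul_distrib]
    refine Finset.prod_congr rfl fun l _ => ?_
    rw [Real.exp_add]
    congr 1
    split_ifs
    · rw [Real.rpow_def_of_pos (hb l), mul_comm]
    · rw [Real.rpow_def_of_pos (ha l), mul_comm]
  have h2 : Real.exp (∑ l, d l) = Real.exp (d i) * Real.exp (∑ l ∈ Finset.univ.erase i, d l) := by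
    rw [← Real.exp_add, Finset.add_sum_erase _ _ (Finset.mem_univ i)]
  have h3 : Real.exp (d i) * (1 / c * (a i ^ c - b i ^ c)) ≤ a i - b i := by
    refine mul_rpow_sub_rpow_le (hb i) (hba i) hc hc1 ?_
    rw [Real.rpow_def_of_pos (hb i), mul_comm]
    exact Real.exp_le_exp.2 hd
  rw [h1, h2]
  have h4 : 0 ≤ (∏ l ∈ Finset.univ.erase i, (if l < i then b l ^ c else a l ^ c)) *
        Real.exp (∑ l ∈ Finset.univ.erase i, d l) := by
    refine mul_nonneg (Finset.prod_nonneg fun l _ => ?_) (Real.exp_pos _).le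
    split_ifs
    · exact Real.rpow_nonneg (hb l).le _
    · exact Real.rpow_nonneg (ha l).le _
  calc _ = Real.exp (d i) * (1 / c * (a i ^ c - b i ^ c)) *
        ((∏ l ∈ Finset.univ.erase i, (if l < i then b l ^ c else a l ^ c)) *
        Real.exp (∑ l ∈ Finset.univ.erase i, d l)) := by ring
    _ ≤ _ := mul_le_mul_of_nonneg_right h3 h4

/-! ### The maximum, admissible quantiles, and nested value levels -/

theorem prophet_le_iff {Ω : Type*} {n : ℕ} (hn : 0 < n) (X : Fin n → Ω → ℝ) (ω : Ω) (y : ℝ) :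
    prophet X ω ≤ y ↔ ∀ i, X i ω ≤ y := by
  have : Nonempty (Fin n) := ⟨⟨0, hn⟩⟩
  exact ciSup_le_iff (Set.finite_range _).bddAbove

theorem le_prophet {Ω : Type*} {n : ℕ} (X : Fin n → Ω → ℝ) (ω : Ω) (i : Fin n) :
    X i ω ≤ prophet X ω :=
  le_ciSup (f := fun i => X i ω) (Set.finite_range _).bddAbove i

theorem Admissible.pos {m : ℕ} {α : ℕ → ℝ} (h : Admissible m α) {k : ℕ} (hk : k ≤ m) :
    0 < α k := by
  have key : ∀ d, d ≤ m → 0 < α (m - d) := by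
    intro d
    induction d with
    | zero =>
      intro _
      have := h.2.2 m le_rfl
      rwa [h.2.1] at this
    | succ d ih =>
      intro hd
      have h1 := h.2.2 (m - (d + 1)) (by omega)
      rw [show m - (d + 1) + 1 = m - d by omega] at h1
      exact (ih (by omega)).trans h1
  have := key (m - k) (by omega)
  rwa [show m - (m - k) = k by omega] at this

theorem Admissible.strictAnti {m : ℕ} {α : ℕ → ℝ} (h : Admissible m α) {i k : ℕ} (hik : i < k)
    (hk : k ≤ m + 1) : α k < α i := by
  induction k, hik using Nat.le_induction with
  | base => exact h.2.2 i (by omega)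
  | succ k hik ih => exact (h.2.2 k (by omega)).trans (ih (by omega))

theorem Admissible.anti {m : ℕ} {α : ℕ → ℝ} (h : Admissible m α) {i k : ℕ} (hik : i ≤ k)
    (hk : k ≤ m + 1) : α k ≤ α i := by
  rcases hik.eq_or_lt with rfl | hlt
  · exact le_rfl
  · exact (h.strictAnti hlt hk).le

theorem Admissible.le_one {m : ℕ} {α : ℕ → ℝ} (h : Admissible m α) {k : ℕ} (hk : k ≤ m + 1) :
    α k ≤ 1 := by
  have := h.anti (Nat.zero_le k) hk
  rwa [h.1] at this

/-- The nested family of value ranges cut out by the thresholds above `x`. -/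
def levelSet (τ : ℕ → ℝ) (j : ℕ) (x : ℝ) (p : ℕ) : Set ℝ :=
  if p = 0 then Set.univ else if p < j then Set.Iic (τ p) else Set.Iic x

theorem measurableSet_levelSet (τ : ℕ → ℝ) (j : ℕ) (x : ℝ) (p : ℕ) :
    MeasurableSet (levelSet τ j x p) := by
  unfold levelSet
  split_ifs
  · exact MeasurableSet.univ
  · exact measurableSet_Iic
  · exact measurableSet_Iic

/-- The level `x` lies between the `j`-th and the `(j - 1)`-st threshold. -/
structure Between (m : ℕ) (τ : ℕ → ℝ) (j : ℕ) (x : ℝ) : Prop where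
  one_le : 1 ≤ j
  le_succ : j ≤ m + 1
  anti : ∀ i k, 1 ≤ i → i ≤ k → k ≤ m → τ k ≤ τ i
  lt_above : ∀ p, 1 ≤ p → p < j → x < τ p
  below_le : ∀ k, j ≤ k → k ≤ m → τ k ≤ x

theorem Between.levelSet_anti {m : ℕ} {τ : ℕ → ℝ} {j : ℕ} {x : ℝ} (h : Between m τ j x)
    {p p' : ℕ} (hp : p ≤ p') : levelSet τ j x p' ⊆ levelSet τ j x p := by
  have := h.one_le
  have := h.le_succ
  unfold levelSet
  split_ifs <;> try omega
  all_goals first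
    | exact Set.subset_univ _
    | exact le_rfl
    | exact Set.Iic_subset_Iic.2 (h.anti _ _ (by omega) hp (by omega))
    | exact Set.Iic_subset_Iic.2 (h.lt_above _ (by omega) (by omega)).le

theorem Between.Iic_subset_levelSet {m : ℕ} {τ : ℕ → ℝ} {j : ℕ} {x : ℝ} (h : Between m τ j x)
    (p : ℕ) : Set.Iic x ⊆ levelSet τ j x p := by
  unfold levelSet
  split_ifs
  · exact Set.subset_univ _
  · exact Set.Iic_subset_Iic.2 (h.lt_above _ (by omega) (by omega)).le
  · exact le_rfl

theorem Between.Iic_threshold_subset_levelSet {m : ℕ} {τ : ℕ → ℝ} {j : ℕ} {x : ℝ}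
    (h : Between m τ j x) {p ν : ℕ} (hp : p ≤ j) (hpν : p ≤ ν) (hν : ν ≤ m) :
    Set.Iic (τ ν) ⊆ levelSet τ j x p := by
  unfold levelSet
  split_ifs
  · exact Set.subset_univ _
  · exact Set.Iic_subset_Iic.2 (h.anti _ _ (by omega) hpν hν)
  · exact Set.Iic_subset_Iic.2 (h.below_le _ (by omega) hν)

theorem Between.levelSet_subset_Iic {m : ℕ} {τ : ℕ → ℝ} {j : ℕ} {x : ℝ}
    (h : Between m τ j x) {p ν : ℕ} (hp : p < j) (h1 : 1 ≤ ν) (hpν : ν ≤ p) :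
    levelSet τ j x p ⊆ Set.Iic (τ ν) := by
  have h2 := h.levelSet_anti hpν
  refine h2.trans ?_
  unfold levelSet
  rw [if_neg (by omega), if_pos (by omega)]

/-! ### Probability of a tagged event -/

section Events

variable {Ω : Type*} [MeasurableSpace Ω] {μ : Measure Ω} {n : ℕ} {X T : Fin n → Ω → ℝ}

theorem IsInstance.real_prophet_le (h : IsInstance μ X T) (hn : 0 < n) (y : ℝ) :
    μ.real {ω | prophet X ω ≤ y} = ∏ l, μ.real {ω | X l ω ≤ y} := by
  have hX : iIndepFun X μ := h.indep.precomp (g := Sum.inl) Sum.inl_injective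
  have h1 := hX.measure_inter_preimage_eq_mul Finset.univ (sets := fun _ => Set.Iic y)
    (fun _ _ => measurableSet_Iic)
  have h2 : {ω | prophet X ω ≤ y} = ⋂ l ∈ Finset.univ, X l ⁻¹' Set.Iic y := by
    ext ω
    simp [prophet_le_iff hn]
  unfold Measure.real
  rw [h2, h1, ENNReal.toReal_prod]
  rfl

/-- The event that `i` has the smallest index among the variables in the highest non-empty level,
`p`, that it arrives in the slot `k`, and that no other variable stands in its way. -/
def taggedEvent (m : ℕ) (τ : ℕ → ℝ) (j : ℕ) (x : ℝ) (X T : Fin n → Ω → ℝ) (k p : ℕ)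
    (i : Fin n) : Set Ω :=
  {ω | (X i ω, T i ω) ∈ (levelSet τ j x p \ levelSet τ j x (p + 1)) ×ˢ
      Set.Ioc (slotStart m k) (slotStart m k + 1 / m) ∧
    ∀ l ≠ i, ((X i ω, T i ω), (X l ω, T l ω)) ∈
      {z : (ℝ × ℝ) × (ℝ × ℝ) | z.2.1 ∈ levelSet τ j x (if l < i then p + 1 else p) ∧
        (z.1.2, z.2) ∈ okSet m τ x k}}

theorem measurableSet_tagged_constraint (m : ℕ) (τ : ℕ → ℝ) (j : ℕ) (x : ℝ) (k p : ℕ) :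
    MeasurableSet {z : (ℝ × ℝ) × (ℝ × ℝ) | z.2.1 ∈ levelSet τ j x p ∧
        (z.1.2, z.2) ∈ okSet m τ x k} :=
  ((measurable_fst.comp measurable_snd) (measurableSet_levelSet τ j x p)).inter
    (((measurable_snd.comp measurable_fst).prodMk measurable_snd) (measurableSet_okSet m τ x k))

theorem IsInstance.measurableSet_taggedEvent (h : IsInstance μ X T) (m : ℕ) (τ : ℕ → ℝ) (j : ℕ)
    (x : ℝ) (k p : ℕ) (i : Fin n) : MeasurableSet (taggedEvent m τ j x X T k p i) := by
  have e : taggedEvent m τ j x X T k p i =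
      (fun ω => (X i ω, T i ω)) ⁻¹' ((levelSet τ j x p \ levelSet τ j x (p + 1)) ×ˢ
        Set.Ioc (slotStart m k) (slotStart m k + 1 / m)) ∩ ⋂ l, ⋂ (_ : l ≠ i),
      (fun ω => ((X i ω, T i ω), (X l ω, T l ω))) ⁻¹'
      {z : (ℝ × ℝ) × (ℝ × ℝ) | z.2.1 ∈ levelSet τ j x (if l < i then p + 1 else p) ∧
        (z.1.2, z.2) ∈ okSet m τ x k} := by
    ext ω
    simp [taggedEvent]
  rw [e]
  refine MeasurableSet.inter ((h.measurable_pair i) (((measurableSet_levelSet τ j x p).diff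
    (measurableSet_levelSet τ j x (p + 1))).prod measurableSet_Ioc)) ?_
  refine MeasurableSet.iInter fun l => MeasurableSet.iInter fun _ => ?_
  exact ((h.measurable_pair i).prodMk (h.measurable_pair l))
    (measurableSet_tagged_constraint m τ j x k _)

variable [IsProbabilityMeasure μ]

/-- Lower bound for the probability of a tagged event. -/
theorem IsInstance.le_measure_taggedEvent (h : IsInstance μ X T) (hn : 0 < n) {m : ℕ}
    (hm : 0 < m) {α τ : ℕ → ℝ} (hpos : ∀ k, 1 ≤ k → k ≤ m → 0 < α k)
    (hq : IsQuantiles μ X m α τ) {j : ℕ} {x : ℝ} (hx : Between m τ j x) {k p : ℕ}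
    (hjk : j ≤ k) (hkm : k ≤ m) (hp : p < j) (i : Fin n) {c : ℝ}
    (hc : c = ((m : ℝ) - ((k : ℝ) - 1) + p) / m) :
    ENNReal.ofReal (1 / c * ((μ.real {ω | X i ω ∈ levelSet τ j x p} ^ c -
          μ.real {ω | X i ω ∈ levelSet τ j x (p + 1)} ^ c) *
        ∏ l ∈ Finset.univ.erase i, (if l < i then μ.real {ω | X l ω ∈ levelSet τ j x (p + 1)} ^ c
          else μ.real {ω | X l ω ∈ levelSet τ j x p} ^ c)) *
        Real.exp (1 / (m : ℝ) * ∑ ν ∈ Finset.Ioo p k, Real.log (α ν))) *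
      ENNReal.ofReal (1 / (m : ℝ) * poissonInv (1 / (m : ℝ) *
        Real.log (μ.real {ω | prophet X ω ≤ x} / α k))) ≤
      μ (taggedEvent m τ j x X T k p i) := by
  have hm' : (0 : ℝ) < m := by exact_mod_cast hm
  have hj1 := hx.one_le
  have hkm' : (k : ℝ) ≤ m := by exact_mod_cast hkm
  set a : Fin n → ℝ := fun l => μ.real {ω | X l ω ∈ levelSet τ j x p} with ha
  set b : Fin n → ℝ := fun l => μ.real {ω | X l ω ∈ levelSet τ j x (p + 1)} with hb
  set F : Fin n → ℕ → ℝ := fun l ν => μ.real {ω | X l ω ≤ τ ν} with hF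
  set v : Fin n → ℝ := fun l => μ.real {ω | X l ω ≤ x} with hv
  set η := μ.real {ω | prophet X ω ≤ x} with hη
  have mono : ∀ (l : Fin n) (A B : Set ℝ), A ⊆ B →
      μ.real {ω | X l ω ∈ A} ≤ μ.real {ω | X l ω ∈ B} := fun l A B hAB =>
    measureReal_mono (fun ω hω => hAB hω)
  have hprodF : ∀ ν, 1 ≤ ν → ν ≤ m → ∏ l, F l ν = α ν := fun ν h1 h2 => by
    rw [← hq ν ⟨h1, h2⟩, h.real_prophet_le hn]
  have hFpos : ∀ l ν, 1 ≤ ν → ν ≤ m → 0 < F l ν := by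
    intro l ν h1 h2
    have h3 := hpos ν h1 h2
    rw [← hprodF ν h1 h2] at h3
    have h4 := Finset.prod_ne_zero_iff.1 h3.ne' l (Finset.mem_univ l)
    exact lt_of_le_of_ne measureReal_nonneg (Ne.symm h4)
  have hFv : ∀ l, F l k ≤ v l := fun l =>
    mono l _ _ (Set.Iic_subset_Iic.2 (hx.below_le k hjk hkm))
  have hvpos : ∀ l, 0 < v l := fun l => (hFpos l k (by omega) hkm).trans_le (hFv l)
  have hvb : ∀ l, v l ≤ b l := fun l => mono l _ _ (hx.Iic_subset_levelSet (p + 1))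
  have hba : ∀ l, b l ≤ a l := fun l => mono l _ _ (hx.levelSet_anti (Nat.le_succ p))
  have hbpos : ∀ l, 0 < b l := fun l => (hvpos l).trans_le (hvb l)
  -- The weights in the AM–GM step sum to `1`.
  have hcard : c + (Finset.Ioo p k).card * (1 / (m : ℝ)) = 1 := by
    rw [hc, Nat.card_Ioo, Nat.cast_sub (by omega), Nat.cast_sub (by omega)]
    push_cast
    field_simp
    ring
  have hcm : 1 / (m : ℝ) ≤ c := by
    rw [hc]
    refine div_le_div_of_nonneg_right ?_ hm'.le
    have : (0 : ℝ) ≤ p := Nat.cast_nonneg p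
    linarith
  have hc0 : 0 < c := lt_of_lt_of_le (by positivity) hcm
  have hc1 : c ≤ 1 := by
    have : (0 : ℝ) ≤ (Finset.Ioo p k).card * (1 / (m : ℝ)) := by positivity
    linarith
  set d : ℝ → Fin n → ℝ := fun t l => 1 / (m : ℝ) * ∑ ν ∈ Finset.Ioo p k, Real.log (F l ν) +
    (t - slotStart m k) * (Real.log (F l k) - Real.log (v l)) with hd
  set y := Real.log (η / α k) with hy
  -- Here the instance disappears: the distribution functions at `τ_ν` multiply to `α_ν`, those at
  -- `x` to `η`, so the total exponent depends on the instance only through `η`.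
  have hdsum : ∀ t, ∑ l, d t l = 1 / (m : ℝ) * ∑ ν ∈ Finset.Ioo p k, Real.log (α ν) +
      -(y * (t - slotStart m k)) := by
    intro t
    simp only [hd]
    rw [Finset.sum_add_distrib, ← Finset.mul_sum, ← Finset.mul_sum, Finset.sum_comm,
      Finset.sum_sub_distrib]
    have e1 : ∑ ν ∈ Finset.Ioo p k, ∑ l, Real.log (F l ν) =
        ∑ ν ∈ Finset.Ioo p k, Real.log (α ν) := by
      refine Finset.sum_congr rfl fun ν hν => ?_
      rw [Finset.mem_Ioo] at hν
      rw [← hprodF ν (by omega) (by omega), Real.log_prod]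
      exact fun l _ => (hFpos l ν (by omega) (by omega)).ne'
    have e2 : ∑ l, Real.log (F l k) = Real.log (α k) := by
      rw [← hprodF k (by omega) (by omega), Real.log_prod]
      exact fun l _ => (hFpos l k (by omega) (by omega)).ne'
    have e3 : ∑ l, Real.log (v l) = Real.log η := by
      rw [hη, h.real_prophet_le hn, Real.log_prod]
      exact fun l _ => (hvpos l).ne'
    have hηpos : 0 < η := by
      rw [hη, h.real_prophet_le hn]
      exact Finset.prod_pos fun l _ => hvpos l
    rw [e1, e2, e3, hy, Real.log_div hηpos.ne' (hpos k (by omega) hkm).ne']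
    ring
  -- The tagged variable contributes no survival factor. This inequality allows `tagged_product_le`
  -- to extract the missing `exp (d t i)` from `a i - b i` by concavity.
  have hdi : ∀ t, slotStart m k ≤ t → d t i ≤ (1 - c) * Real.log (b i) := by
    intro t ht
    have e1 : ∑ ν ∈ Finset.Ioo p k, Real.log (F i ν) ≤
        (Finset.Ioo p k).card * Real.log (b i) := by
      rw [← nsmul_eq_mul]
      refine Finset.sum_le_card_nsmul _ _ _ fun ν hν => ?_
      rw [Finset.mem_Ioo] at hν
      refine Real.log_le_log (hFpos i ν (by omega) (by omega)) (mono i (Set.Iic (τ ν)) _ ?_)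
      exact hx.Iic_threshold_subset_levelSet (by omega) (by omega) (by omega)
    have e2 : (t - slotStart m k) * (Real.log (F i k) - Real.log (v i)) ≤ 0 :=
      mul_nonpos_of_nonneg_of_nonpos (by linarith)
        (sub_nonpos.2 (Real.log_le_log (hFpos i k (by omega) hkm) (hFv i)))
    have e3 := mul_le_mul_of_nonneg_left e1 (by positivity : (0 : ℝ) ≤ 1 / (m : ℝ))
    have e4 : 1 - c = (Finset.Ioo p k).card * (1 / (m : ℝ)) := by linarith
    simp only [hd]
    rw [e4]
    linarith
  have hsurv : ∀ t ∈ Set.Ioc (slotStart m k) (slotStart m k + 1 / m), ∀ l,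
      ENNReal.ofReal (Real.exp (c * Real.log (if l < i then b l else a l) + d t l)) ≤
      μ {ω | X l ω ∈ levelSet τ j x (if l < i then p + 1 else p) ∧
        (t, (X l ω, T l ω)) ∈ okSet m τ x k} := by
    intro t ht l
    have e1 := h.survival_le_real l hm (p := p) (k := k) (τ := τ) (x := x) (t := t)
      (U := levelSet τ j x (if l < i then p + 1 else p)) (by omega) (measurableSet_levelSet _ _ _ _)
      (fun ν h1 h2 => (hx.levelSet_anti (by split_ifs <;> omega)).trans
        (hx.levelSet_subset_Iic hp h1 h2))
      (fun ν h1 h2 => hx.Iic_threshold_subset_levelSet (by split_ifs <;> omega)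
        (by split_ifs <;> omega) (by omega))
      (hx.below_le k hjk hkm) ht.1.le
    have hu : μ.real {ω | X l ω ∈ levelSet τ j x (if l < i then p + 1 else p)} =
        if l < i then b l else a l := by
      split_ifs <;> rfl
    rw [hu, ← hc] at e1
    have e2 := exp_le_survival (m := m) (I := Finset.Ioo p k) (a := F l)
      (u := if l < i then b l else a l) (v := v l) (b := F l k) (c := c)
      (s := t - slotStart m k)
      (fun ν hν => by
        rw [Finset.mem_Ioo] at hν
        exact hFpos l ν (by omega) (by omega))
      (hFpos l k (by omega) hkm) (hFv l)
      (by split_ifs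
          · exact hvb l
          · exact (hvb l).trans (hba l))
      (by linarith [ht.1]) (by linarith [ht.2]) hcard
    rw [ENNReal.ofReal_le_iff_le_toReal (measure_ne_top _ _)]
    exact e2.trans e1
  rw [taggedEvent, measure_and_forall_ne_eq_setLIntegral h.measurable_pair h.iIndepFun_pair i
    (((measurableSet_levelSet τ j x p).diff (measurableSet_levelSet τ j x (p + 1))).prod
      measurableSet_Ioc) (fun l => measurableSet_tagged_constraint m τ j x k _)]
  have hA : μ {ω | X i ω ∈ levelSet τ j x p \ levelSet τ j x (p + 1)} =
      ENNReal.ofReal (a i - b i) := by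
    rw [← ofReal_measureReal]
    congr 1
    exact measureReal_sdiff (μ := μ) (s₁ := {ω | X i ω ∈ levelSet τ j x p})
      (s₂ := {ω | X i ω ∈ levelSet τ j x (p + 1)})
      (fun ω hω => hx.levelSet_anti (Nat.le_succ p) hω)
      ((h.measurable_value i) (measurableSet_levelSet _ _ _ _))
  set g : ℝ → ENNReal := fun t => ENNReal.ofReal (∏ l ∈ Finset.univ.erase i,
    Real.exp (c * Real.log (if l < i then b l else a l) + d t l)) with hg
  have hgm : Measurable g := by
    refine ENNReal.measurable_ofReal.comp ?_
    refine Continuous.measurable ?_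
    refine continuous_finsetProd _ fun l _ => ?_
    simp only [hd]
    fun_prop
  calc _ = ∫⁻ t in Set.Ioc (slotStart m k) (slotStart m k + 1 / m),
        ENNReal.ofReal (1 / c * ((a i ^ c - b i ^ c) *
        ∏ l ∈ Finset.univ.erase i, (if l < i then b l ^ c else a l ^ c)) *
        Real.exp (1 / (m : ℝ) * ∑ ν ∈ Finset.Ioo p k, Real.log (α ν))) *
        ENNReal.ofReal (Real.exp (-(y * (t - slotStart m k)))) := by
        rw [lintegral_const_mul _ (by fun_prop), setLIntegral_exp_slot _ _ _ (by positivity)]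
    _ ≤ ∫⁻ t in Set.Ioc (slotStart m k) (slotStart m k + 1 / m),
        ENNReal.ofReal (a i - b i) * g t := by
        refine setLIntegral_mono' measurableSet_Ioc fun t ht => ?_
        rw [hg]
        dsimp only
        rw [← ENNReal.ofReal_mul' (Real.exp_pos _).le,
          ← ENNReal.ofReal_mul (sub_nonneg.2 (hba i))]
        refine ENNReal.ofReal_le_ofReal ?_
        rw [mul_assoc, ← Real.exp_add, ← hdsum t]
        exact tagged_product_le i hc0 hc1 hbpos hba (hdi t ht.1.le)
    -- The factor `1` puts the integrand in product form: value and time of `i` are independent, so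
    -- the integral factors over the rectangle.
    _ = ∫⁻ z in (levelSet τ j x p \ levelSet τ j x (p + 1)) ×ˢ
          Set.Ioc (slotStart m k) (slotStart m k + 1 / m), 1 * g z.2
          ∂(μ.map fun ω => (X i ω, T i ω)) := by
        rw [h.map_pair i, ← Measure.prod_restrict,
          lintegral_prod_mul aemeasurable_const hgm.aemeasurable, lintegral_const_mul _ hgm,
          Measure.restrict_restrict measurableSet_Ioc,
          Set.inter_eq_self_of_subset_left (Ioc_slot_subset_Icc hm (by omega) hkm)]
        congr 1
        rw [lintegral_one, Measure.restrict_apply_univ, Measure.map_apply (h.measurable_value i)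
          ((measurableSet_levelSet τ j x p).diff (measurableSet_levelSet τ j x (p + 1))), ← hA]
        rfl
    _ ≤ _ := by
        refine setLIntegral_mono' (((measurableSet_levelSet τ j x p).diff
          (measurableSet_levelSet τ j x (p + 1))).prod measurableSet_Ioc) fun z hz => ?_
        rw [one_mul, hg]
        dsimp only
        rw [ENNReal.ofReal_prod_of_nonneg fun l _ => (Real.exp_pos _).le]
        exact Finset.prod_le_prod' fun l _ => hsurv z.2 hz.2 l

end Events

/-! ### Existence and uniqueness of the selected variable -/

section Selection

variable {Ω : Type*} {n : ℕ} {m : ℕ} {τ : ℕ → ℝ} {X T : Fin n → Ω → ℝ} {ω : Ω}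

theorem exists_selected_of_passes {i : Fin n} (hi : Passes m τ X T ω i) :
    ∃ s, Selected m τ X T ω s ∧ T s ω ≤ T i ω := by
  classical
  -- The lexicographic order on (time, index) encodes the tie-breaking rule of `Selected`.
  obtain ⟨s, hs, hmin⟩ := Finset.exists_min_image
    (Finset.univ.filter fun l => Passes m τ X T ω l) (fun l => toLex (T l ω, l))
    ⟨i, by simp [hi]⟩
  have key : ∀ l, Passes m τ X T ω l → T s ω < T l ω ∨ (T s ω = T l ω ∧ s ≤ l) := by
    intro l hl
    have := hmin l (by simp [hl])
    simpa [Prod.Lex.le_iff] using this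
  refine ⟨s, ⟨(Finset.mem_filter.1 hs).2, key⟩, ?_⟩
  rcases key i hi with h | h
  · exact h.le
  · exact h.1.le

theorem Selected.unique {s s' : Fin n} (h : Selected m τ X T ω s) (h' : Selected m τ X T ω s') :
    s = s' := by
  rcases h.2 s' h'.1 with h1 | h1
  · rcases h'.2 s h.1 with h2 | h2
    · exact absurd h1 h2.not_gt
    · exact absurd h2.1 h1.ne'
  · rcases h'.2 s h.1 with h2 | h2
    · exact absurd h1.1 h2.ne'
    · exact le_antisymm h1.2 h2.2

theorem reward_eq_of_selected {s : Fin n} (h : Selected m τ X T ω s) :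
    reward m τ X T ω = X s ω := by
  unfold reward
  rw [Finset.sum_eq_single s]
  · simp [h]
  · intro l _ hl
    rw [if_neg]
    exact fun h' => hl (h'.unique h)
  · simp

end Selection

/-! ### Measurability of the reward, and acceptance before slot `j` -/

section Reward

variable {Ω : Type*} [MeasurableSpace Ω] {μ : Measure Ω} {n : ℕ} {X T : Fin n → Ω → ℝ}

theorem IsInstance.measurable_reward (h : IsInstance μ X T) (m : ℕ) (τ : ℕ → ℝ) :
    Measurable (reward m τ X T) := by
  classical
  have hP : ∀ i, MeasurableSet {ω | Passes m τ X T ω i} := fun i =>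
    measurableSet_le ((measurable_from_top (f := τ)).comp
      ((measurable_slot m).comp (h.measurable_time i))) (h.measurable_value i)
  have hS : ∀ i, MeasurableSet {ω | Selected m τ X T ω i} := by
    intro i
    refine (hP i).inter ?_
    have : {ω | ∀ l, Passes m τ X T ω l → T i ω < T l ω ∨ (T i ω = T l ω ∧ i ≤ l)} =
        ⋂ l, ({ω | Passes m τ X T ω l}ᶜ ∪ ({ω | T i ω < T l ω} ∪
          ({ω | T i ω = T l ω} ∩ {_ω | i ≤ l}))) := by
      ext ω
      simp [imp_iff_not_or]
    change MeasurableSet {ω | ∀ l, Passes m τ X T ω l → T i ω < T l ω ∨ (T i ω = T l ω ∧ i ≤ l)}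
    rw [this]
    refine MeasurableSet.iInter fun l => (hP l).compl.union ?_
    exact (measurableSet_lt (h.measurable_time i) (h.measurable_time l)).union
      ((measurableSet_eq_fun (h.measurable_time i) (h.measurable_time l)).inter
        (MeasurableSet.const _))
  unfold reward
  refine Finset.measurable_sum _ fun i _ => ?_
  exact Measurable.ite (hS i) (h.measurable_value i) measurable_const

theorem IsInstance.reward_nonneg (h : IsInstance μ X T) (m : ℕ) (τ : ℕ → ℝ) :
    0 ≤ᵐ[μ] reward m τ X T := by
  have : ∀ᵐ ω ∂μ, ∀ i, 0 ≤ X i ω := ae_all_iff.2 h.value_nonneg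
  filter_upwards [this] with ω hω
  refine Finset.sum_nonneg fun i _ => ?_
  split_ifs
  · exact hω i
  · exact le_rfl

theorem IsInstance.measurable_prophet (h : IsInstance μ X T) (hn : 0 < n) :
    Measurable (prophet X) := by
  refine measurable_of_Iic fun y => ?_
  have : prophet X ⁻¹' Set.Iic y = ⋂ i, X i ⁻¹' Set.Iic y := by
    ext ω
    simp [prophet_le_iff hn]
  rw [this]
  exact MeasurableSet.iInter fun i => (h.measurable_value i) measurableSet_Iic

theorem IsInstance.prophet_nonneg (h : IsInstance μ X T) (hn : 0 < n) : 0 ≤ᵐ[μ] prophet X := by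
  filter_upwards [h.value_nonneg ⟨0, hn⟩] with ω hω
  exact hω.trans (le_prophet X ω _)

/-- The event that some variable is accepted before the slot `j`. -/
def earlyEvent (m : ℕ) (τ : ℕ → ℝ) (j : ℕ) (X T : Fin n → Ω → ℝ) : Set Ω :=
  {ω | ∃ i, slot m (T i ω) < j ∧ τ (slot m (T i ω)) ≤ X i ω}

theorem measurableSet_accepted_before (m : ℕ) (τ : ℕ → ℝ) (j : ℕ) :
    MeasurableSet {z : ℝ × ℝ | slot m z.2 < j ∧ τ (slot m z.2) ≤ z.1} := by
  have h1 : Measurable fun z : ℝ × ℝ => slot m z.2 := (measurable_slot m).comp measurable_snd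
  exact (measurableSet_lt h1 measurable_const).inter
    (measurableSet_le ((measurable_from_top (f := τ)).comp h1) measurable_fst)

theorem IsInstance.measurableSet_earlyEvent (h : IsInstance μ X T) (m : ℕ) (τ : ℕ → ℝ) (j : ℕ) :
    MeasurableSet (earlyEvent m τ j X T) := by
  have : earlyEvent m τ j X T = ⋃ i, (fun ω => (X i ω, T i ω)) ⁻¹'
      {z : ℝ × ℝ | slot m z.2 < j ∧ τ (slot m z.2) ≤ z.1} := by
    ext ω
    simp [earlyEvent]
  rw [this]
  exact MeasurableSet.iUnion fun i => h.measurable_pair i (measurableSet_accepted_before m τ j)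

variable [IsProbabilityMeasure μ]

/-- A single variable is accepted early with probability at least `(1/m) ∑ (1 - P(X_l ≤ τ_k))`, the
slots being disjoint. Independence gives the product of the complements, and Chebyshev through
`prod_one_sub_le` compares it with the same expression for the maximum. -/
theorem IsInstance.le_real_earlyEvent (h : IsInstance μ X T) (hn : 0 < n) {m : ℕ}
    (hm : 0 < m) {α τ : ℕ → ℝ} (hq : IsQuantiles μ X m α τ) {j : ℕ} {x : ℝ}
    (hx : Between m τ j x) :
    1 / (m : ℝ) * ∑ k ∈ Finset.Ico 1 j, (1 - α k) ≤ μ.real (earlyEvent m τ j X T) := by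
  have hm' : (0 : ℝ) < m := by exact_mod_cast hm
  have hjm := hx.le_succ
  set A := {z : ℝ × ℝ | slot m z.2 < j ∧ τ (slot m z.2) ≤ z.1} with hA
  have hAm : MeasurableSet A := measurableSet_accepted_before m τ j
  have hone : ∀ l, 1 / (m : ℝ) * ∑ k ∈ Finset.Ico 1 j, (1 - μ.real {ω | X l ω ≤ τ k}) ≤
      μ.real ((fun ω => (X l ω, T l ω)) ⁻¹' A) := by
    intro l
    set B : ℕ → Set Ω := fun k => {ω | X l ω ∈ Set.Ioi (τ k) ∧
      T l ω ∈ Set.Ioc (slotStart m k) (slotStart m k + 1 / m)} with hB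
    have hBm : ∀ k, MeasurableSet (B k) := fun k =>
      ((h.measurable_value l) measurableSet_Ioi).inter ((h.measurable_time l) measurableSet_Ioc)
    have hBs : ∀ k ∈ Finset.Ico 1 j, ∀ ω ∈ B k, slot m (T l ω) = k := fun k hk ω hω =>
      slot_eq_of_mem_Ioc hm (Finset.mem_Ico.1 hk).1 hω.2
    have hdisj : Set.PairwiseDisjoint (↑(Finset.Ico 1 j)) B := by
      intro k hk k' hk' hne
      refine Set.disjoint_left.2 fun ω h1 h2 => hne ?_
      rw [← hBs k hk ω h1, hBs k' hk' ω h2]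
    have hsub : (⋃ k ∈ Finset.Ico 1 j, B k) ⊆ (fun ω => (X l ω, T l ω)) ⁻¹' A := by
      intro ω hω
      obtain ⟨k, hk, hω⟩ := Set.mem_iUnion₂.1 hω
      have e := hBs k hk ω hω
      refine ⟨?_, ?_⟩
      · rw [e]
        exact (Finset.mem_Ico.1 hk).2
      · dsimp only
        rw [e]
        exact le_of_lt hω.1
    refine le_trans (le_of_eq ?_) (measureReal_mono hsub)
    rw [measureReal_biUnion_finset hdisj (fun k _ => hBm k), Finset.mul_sum]
    refine Finset.sum_congr rfl fun k hk => ?_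
    rw [Finset.mem_Ico] at hk
    have e1 : μ.real {ω | X l ω ∈ Set.Ioi (τ k)} = 1 - μ.real {ω | X l ω ≤ τ k} := by
      rw [← probReal_compl_eq_one_sub (s := {ω | X l ω ≤ τ k})
        ((h.measurable_value l) measurableSet_Iic)]
      congr 1
      ext ω
      simp
    rw [hB]
    unfold Measure.real
    rw [h.measure_rect l measurableSet_Ioi measurableSet_Ioc, ENNReal.toReal_mul,
      Set.inter_eq_self_of_subset_left (Ioc_slot_subset_Icc hm hk.1 (by omega)),
      Real.volume_Ioc, add_sub_cancel_left, ENNReal.toReal_ofReal (by positivity)]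
    change _ = μ.real {ω | X l ω ∈ Set.Ioi (τ k)} * _
    rw [e1, mul_comm]
    rfl
  have hcompl : μ.real (earlyEvent m τ j X T)ᶜ =
      ∏ l, μ.real ((fun ω => (X l ω, T l ω)) ⁻¹' Aᶜ) := by
    have e1 : (earlyEvent m τ j X T)ᶜ =
        ⋂ l ∈ Finset.univ, (fun ω => (X l ω, T l ω)) ⁻¹' Aᶜ := by
      ext ω
      simp [earlyEvent, hA]
    unfold Measure.real
    rw [e1, h.iIndepFun_pair.measure_inter_preimage_eq_mul _ (sets := fun _ => Aᶜ)
      (fun _ _ => hAm.compl), ENNReal.toReal_prod]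
  have hprod : ∏ l, μ.real ((fun ω => (X l ω, T l ω)) ⁻¹' Aᶜ) ≤
      ∏ l, (1 - 1 / (m : ℝ) * ∑ k ∈ Finset.Ico 1 j, (1 - μ.real {ω | X l ω ≤ τ k})) := by
    refine Finset.prod_le_prod (fun l _ => measureReal_nonneg) fun l _ => ?_
    rw [Set.preimage_compl, probReal_compl_eq_one_sub (h.measurable_pair l hAm)]
    linarith [hone l]
  have hcheb := prod_one_sub_le Finset.univ (Finset.Ico 1 j) hm (by simp; omega)
    (fun l k => μ.real {ω | X l ω ≤ τ k}) (fun l k _ => measureReal_nonneg)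
    (fun l k _ => measureReal_le_one) (fun l k hk k' hk' hkk' => by
      rw [Finset.coe_Ico, Set.mem_Ico] at hk hk'
      exact measureReal_mono fun ω hω =>
        le_trans (show X l ω ≤ τ k' from hω) (hx.anti k k' hk.1 hkk' (by omega)))
  have hsum : ∑ k ∈ Finset.Ico 1 j, (1 - ∏ l, μ.real {ω | X l ω ≤ τ k}) =
      ∑ k ∈ Finset.Ico 1 j, (1 - α k) := by
    refine Finset.sum_congr rfl fun k hk => ?_
    rw [Finset.mem_Ico] at hk
    rw [← h.real_prophet_le hn, hq k ⟨hk.1, by omega⟩]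
  rw [hsum] at hcheb
  rw [probReal_compl_eq_one_sub (h.measurableSet_earlyEvent m τ j)] at hcompl
  linarith

end Reward

/-! ### Early and tagged events force a reward above `x`, and are disjoint -/

section Containment

variable {Ω : Type*} {n : ℕ} {m : ℕ} {τ : ℕ → ℝ} {j : ℕ} {x : ℝ} {X T : Fin n → Ω → ℝ}

/-- The selected variable arrives no later than the accepted one, hence also before slot `j`, where
every threshold exceeds `x`. -/
theorem lt_reward_of_mem_earlyEvent (hx : Between m τ j x) {ω : Ω}
    (hω : ω ∈ earlyEvent m τ j X T) : x < reward m τ X T ω := by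
  obtain ⟨i, hi, hpass⟩ := hω
  obtain ⟨s, hs, hsT⟩ := exists_selected_of_passes (m := m) (τ := τ) (X := X) (T := T) hpass
  rw [reward_eq_of_selected hs]
  have h1 : slot m (T s ω) < j := (slot_mono m hsT).trans_lt hi
  exact (hx.lt_above _ (one_le_slot m _) h1).trans_le hs.1

/-- The tagged variable passes, so the selected one arrives no later. If it is a different variable,
`okSet` rules out an earlier slot as well as a value at most `x` in slot `k`. -/
theorem lt_reward_of_mem_taggedEvent (hm : 0 < m) (hx : Between m τ j x) {k p : ℕ} (hjk : j ≤ k)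
    (hkm : k ≤ m) {i : Fin n} {ω : Ω} (hω : ω ∈ taggedEvent m τ j x X T k p i) :
    x < reward m τ X T ω := by
  have hj := hx.one_le
  obtain ⟨hi, hl⟩ := hω
  have hslot : slot m (T i ω) = k := slot_eq_of_mem_Ioc hm (by omega) hi.2
  have hxi : x < X i ω := by
    by_contra hcon
    exact hi.1.2 (hx.Iic_subset_levelSet (p + 1) (not_lt.1 hcon))
  have hpass : Passes m τ X T ω i := by
    rw [Passes, stepThreshold_eq, hslot]
    exact (hx.below_le k hjk hkm).trans hxi.le
  obtain ⟨s, hs, hsT⟩ := exists_selected_of_passes hpass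
  rw [reward_eq_of_selected hs]
  rcases eq_or_ne s i with rfl | hne
  · exact hxi
  · obtain ⟨h1, h2⟩ := (hl s hne).2
    have hp := hs.1
    rw [Passes, stepThreshold_eq] at hp
    have hle : slot m (T s ω) ≤ k := hslot ▸ slot_mono m hsT
    rcases hle.lt_or_eq with hlt | heq
    · exact absurd ⟨hlt, hp⟩ h1
    · by_contra hcon
      rw [heq] at hp
      exact h2 ⟨heq, hsT, hp, not_lt.1 hcon⟩

theorem disjoint_earlyEvent_taggedEvent (hm : 0 < m) (_ : 1 ≤ j) {k p : ℕ} (hjk : j ≤ k)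
    (i : Fin n) : Disjoint (earlyEvent m τ j X T) (taggedEvent m τ j x X T k p i) := by
  refine Set.disjoint_left.2 fun ω h1 h2 => ?_
  obtain ⟨l, hlj, hl⟩ := h1
  obtain ⟨hi, ho⟩ := h2
  have hslot : slot m (T i ω) = k := slot_eq_of_mem_Ioc hm (by omega) hi.2
  rcases eq_or_ne l i with rfl | hne
  · omega
  · exact (ho l hne).2.1 ⟨lt_of_lt_of_le hlj hjk, hl⟩

/-- All three labels can be read off the outcome: `p` is the last level containing every value, `i`
the least index outside level `p + 1`, and `k` the slot of `i`. -/
theorem taggedEvent_index_unique (hm : 0 < m) (hx : Between m τ j x) {k p k' p' : ℕ}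
    (hk : 1 ≤ k) (hk' : 1 ≤ k') {i i' : Fin n} {ω : Ω}
    (hω : ω ∈ taggedEvent m τ j x X T k p i) (hω' : ω ∈ taggedEvent m τ j x X T k' p' i') :
    k = k' ∧ p = p' ∧ i = i' := by
  have all_mem : ∀ {k p : ℕ} {i : Fin n}, ω ∈ taggedEvent m τ j x X T k p i →
      ∀ l, X l ω ∈ levelSet τ j x p := by
    intro k p i hω l
    rcases eq_or_ne l i with rfl | hne
    · exact hω.1.1.1
    · exact hx.levelSet_anti (by split_ifs <;> omega) (hω.2 l hne).1
  have hpp : p = p' := by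
    rcases lt_trichotomy p p' with hlt | heq | hlt
    · exact absurd (hx.levelSet_anti hlt (all_mem hω' i)) hω.1.1.2
    · exact heq
    · exact absurd (hx.levelSet_anti hlt (all_mem hω i')) hω'.1.1.2
  subst hpp
  have hii : i = i' := by
    rcases lt_trichotomy i i' with hlt | heq | hlt
    · have := (hω'.2 i hlt.ne).1
      rw [if_pos hlt] at this
      exact absurd this hω.1.1.2
    · exact heq
    · have := (hω.2 i' hlt.ne).1
      rw [if_pos hlt] at this
      exact absurd this hω'.1.1.2
  subst hii
  refine ⟨?_, rfl, rfl⟩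
  rw [← slot_eq_of_mem_Ioc hm hk hω.1.2, slot_eq_of_mem_Ioc hm hk' hω'.1.2]

end Containment

/-! ### Closed form of the weights `w_k` -/

theorem alphaHat_pos {m : ℕ} {α : ℕ → ℝ} (hα : Admissible m α) {j : ℕ} (hjm : j ≤ m + 1)
    {η : ℝ} (hη : 0 < η) (ν : ℕ) : 0 < alphaHat α j η ν := by
  unfold alphaHat
  split_ifs
  · exact hα.pos (by omega)
  · exact hη

/-- Summation by parts: the coefficients in `r` grow by `1 / m` from one index to the next, so each
interior logarithm keeps weight `1 / m`. The bottom term vanishes because `α 0 = 1`. -/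
theorem s_eq {m : ℕ} (hm : 0 < m) {α : ℕ → ℝ} (hα : Admissible m α) {j : ℕ} (hjm : j ≤ m + 1)
    {η : ℝ} (hη : 0 < η) (k : ℕ) {p : ℕ} (hp : p < j) :
    s m α j η k p = -(((m : ℝ) - ((k : ℝ) - 1) + p) / m * Real.log (alphaHat α j η p)) +
      1 / (m : ℝ) * ∑ ν ∈ Finset.Ico 1 (p + 1), Real.log (α ν) := by
  have hm' : (m : ℝ) ≠ 0 := by positivity
  induction p with
  | zero => simp [s, alphaHat, hp, hα.1]
  | succ p ih =>
    have h1 := ih (by omega)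
    rw [s, Finset.sum_range_succ]
    rw [s] at h1
    rw [h1, r, Real.log_div (alphaHat_pos hα hjm hη p).ne' (alphaHat_pos hα hjm hη (p + 1)).ne',
      Finset.sum_Ico_succ_top (by omega : 1 ≤ p + 1)]
    have h2 : alphaHat α j η (p + 1) = α (p + 1) := by simp [alphaHat, hp]
    rw [h2]
    push_cast
    field_simp
    ring

/-- The weights `w_k`, together with the probability that nothing is accepted before the slot `k`,
as a sum over the levels. -/
theorem prod_rpow_mul_w {m : ℕ} (hm : 0 < m) {α : ℕ → ℝ} (hα : Admissible m α) {j : ℕ}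
    {η : ℝ} (hη : 0 < η) {k : ℕ} (hjk : j ≤ k) (hkm : k ≤ m) :
    (∏ ν ∈ Finset.Ico 1 k, α ν) ^ (1 / (m : ℝ)) * w m α j η k =
      ∑ p ∈ Finset.range j, 1 / ((m : ℝ) - ((k : ℝ) - 1) + p) *
        (alphaHat α j η p ^ (((m : ℝ) - ((k : ℝ) - 1) + p) / m) -
          alphaHat α j η (p + 1) ^ (((m : ℝ) - ((k : ℝ) - 1) + p) / m)) *
        Real.exp (1 / (m : ℝ) * ∑ ν ∈ Finset.Ioo p k, Real.log (α ν)) := by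
  have hprod : (∏ ν ∈ Finset.Ico 1 k, α ν) ^ (1 / (m : ℝ)) =
      Real.exp (1 / (m : ℝ) * ∑ ν ∈ Finset.Ico 1 k, Real.log (α ν)) := by
    have hpos : ∀ ν ∈ Finset.Ico 1 k, 0 < α ν := fun ν hν => hα.pos (by
      rw [Finset.mem_Ico] at hν
      omega)
    rw [Real.rpow_def_of_pos (Finset.prod_pos hpos), Real.log_prod fun ν hν => (hpos ν hν).ne',
      mul_comm]
  rw [hprod, w, Finset.mul_sum]
  refine Finset.sum_congr rfl fun p hp => ?_
  rw [Finset.mem_range] at hp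
  set c := ((m : ℝ) - ((k : ℝ) - 1) + p) / m with hc
  have e1 := s_eq hm hα (by omega : j ≤ m + 1) hη k hp
  have hr : r m α j η k p = c * (Real.log (alphaHat α j η p) -
      Real.log (alphaHat α j η (p + 1))) := by
    rw [r, Real.log_div (alphaHat_pos hα (by omega) hη p).ne'
      (alphaHat_pos hα (by omega) hη (p + 1)).ne']
  have hsplit : ∑ ν ∈ Finset.Ico 1 k, Real.log (α ν) =
      ∑ ν ∈ Finset.Ico 1 (p + 1), Real.log (α ν) + ∑ ν ∈ Finset.Ioo p k, Real.log (α ν) := by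
    have : Finset.Ioo p k = Finset.Ico (p + 1) k := by
      ext ν
      simp
    rw [this, Finset.sum_Ico_consecutive _ (by omega) (by omega)]
  rw [← hc] at e1
  have e2 : Real.exp (1 / (m : ℝ) * ∑ ν ∈ Finset.Ico 1 k, Real.log (α ν)) *
      (Real.exp (-s m α j η k p) * (1 - Real.exp (-r m α j η k p))) =
      (alphaHat α j η p ^ c - alphaHat α j η (p + 1) ^ c) *
        Real.exp (1 / (m : ℝ) * ∑ ν ∈ Finset.Ioo p k, Real.log (α ν)) := by
    rw [Real.rpow_def_of_pos (alphaHat_pos hα (by omega) hη p),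
      Real.rpow_def_of_pos (alphaHat_pos hα (by omega) hη (p + 1)), hsplit, e1, hr, mul_sub,
      mul_sub, sub_mul, mul_one, ← Real.exp_add, ← Real.exp_add, ← Real.exp_add, ← Real.exp_add,
      ← Real.exp_add]
    congr 1 <;> (congr 1; ring)
  calc _ = Real.exp (1 / (m : ℝ) * ∑ ν ∈ Finset.Ico 1 k, Real.log (α ν)) *
      (Real.exp (-s m α j η k p) * (1 - Real.exp (-r m α j η k p))) *
      (1 / ((m : ℝ) - ((k : ℝ) - 1) + p)) := by ring
    _ = _ := by
      rw [e2]
      ring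

theorem ofReal_sum_le {ι : Type*} (I : Finset ι) (g : ι → ℝ) :
    ENNReal.ofReal (∑ i ∈ I, g i) ≤ ∑ i ∈ I, ENNReal.ofReal (g i) :=
  Finset.le_sum_of_subadditive ENNReal.ofReal ENNReal.ofReal_zero.le
    (fun _ _ => ENNReal.ofReal_add_le) I g

/-! ### Tail bound for the reward -/

section Tail

variable {Ω : Type*} [MeasurableSpace Ω] {μ : Measure Ω} [IsProbabilityMeasure μ] {n : ℕ}
  {X T : Fin n → Ω → ℝ}

/-- By independence, passing from single variables to the maximum turns level `p` into the quantile
`α̂_p`; level `0` is the whole line, matching `α 0 = 1`. -/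
theorem IsInstance.prod_levelSet (h : IsInstance μ X T) (hn : 0 < n) {m : ℕ} {α τ : ℕ → ℝ}
    (hα : Admissible m α) (hq : IsQuantiles μ X m α τ) {j : ℕ} {x : ℝ} (hx : Between m τ j x)
    (p : ℕ) :
    ∏ l, μ.real {ω | X l ω ∈ levelSet τ j x p} =
      alphaHat α j (μ.real {ω | prophet X ω ≤ x}) p := by
  have hj := hx.one_le
  have hjm := hx.le_succ
  unfold levelSet alphaHat
  split_ifs with h1 h2 h2 <;> try omega
  · simp [h1, hα.1]
  · rw [← hq p ⟨by omega, by omega⟩, h.real_prophet_le hn]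
    rfl
  · rw [h.real_prophet_le hn]
    rfl

/-- Lower bound for the tail of the reward. -/
theorem IsInstance.ofReal_f_le_measure_lt_reward (h : IsInstance μ X T) (hn : 0 < n) {m : ℕ}
    (hm : 0 < m) {α τ : ℕ → ℝ} (hα : Admissible m α) (hq : IsQuantiles μ X m α τ) {j : ℕ} {x : ℝ}
    (hx : Between m τ j x) :
    ENNReal.ofReal (f m α j (μ.real {ω | prophet X ω ≤ x})) ≤ μ {ω | x < reward m τ X T ω} := by
  have hm' : (0 : ℝ) < m := by exact_mod_cast hm
  have hj := hx.one_le
  have hjm := hx.le_succ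
  set η := μ.real {ω | prophet X ω ≤ x} with hη
  have hpos : ∀ k, 1 ≤ k → k ≤ m → 0 < α k := fun k _ hk => hα.pos hk
  have htag : ∀ k ∈ Finset.Icc j m, ∀ p ∈ Finset.range j,
      ENNReal.ofReal (1 / ((m : ℝ) - ((k : ℝ) - 1) + p) *
        (alphaHat α j η p ^ (((m : ℝ) - ((k : ℝ) - 1) + p) / m) -
          alphaHat α j η (p + 1) ^ (((m : ℝ) - ((k : ℝ) - 1) + p) / m)) *
        Real.exp (1 / (m : ℝ) * ∑ ν ∈ Finset.Ioo p k, Real.log (α ν)) * q m α η k) ≤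
      ∑ i, μ (taggedEvent m τ j x X T k p i) := by
    intro k hk p hp
    rw [Finset.mem_Icc] at hk
    rw [Finset.mem_range] at hp
    set c := ((m : ℝ) - ((k : ℝ) - 1) + p) / m with hc
    refine le_trans ?_ (Finset.sum_le_sum fun i _ =>
      h.le_measure_taggedEvent hn hm hpos hq hx hk.1 hk.2 hp i hc)
    rw [← Finset.sum_mul, ← hη]
    refine le_trans ?_ (mul_le_mul_left (ofReal_sum_le _ _) _)
    -- The sum over the tagged index telescopes to a difference of two products over all variables,
    -- which are powers of `α̂_p` and `α̂_{p+1}`.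
    rw [← ENNReal.ofReal_mul' (mul_nonneg (by positivity) (poissonInv_nonneg _)),
      ← Finset.sum_mul, ← Finset.mul_sum,
      sum_sub_mul_prod_ordered (fun l => μ.real {ω | X l ω ∈ levelSet τ j x p} ^ c)
        (fun l => μ.real {ω | X l ω ∈ levelSet τ j x (p + 1)} ^ c),
      Real.finsetProd_rpow _ _ (fun l _ => measureReal_nonneg),
      Real.finsetProd_rpow _ _ (fun l _ => measureReal_nonneg),
      h.prod_levelSet hn hα hq hx, h.prod_levelSet hn hα hq hx, ← q_eq_poissonInv, ← hη]
    refine ENNReal.ofReal_le_ofReal (le_of_eq ?_)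
    have h1 : (m : ℝ) - ((k : ℝ) - 1) + p = m * c := by
      rw [hc]
      field_simp
    clear_value c
    rw [h1]
    ring
  have hk : ∀ k ∈ Finset.Icc j m,
      ENNReal.ofReal ((∏ ν ∈ Finset.Ico 1 k, α ν) ^ (1 / (m : ℝ)) * w m α j η k * q m α η k) ≤
      ∑ p ∈ Finset.range j, ∑ i, μ (taggedEvent m τ j x X T k p i) := by
    intro k hk
    have hk' := Finset.mem_Icc.1 hk
    -- A late slot `k` has `τ_k ≤ x`, hence `η ≥ α_k > 0`. When `j = m + 1` there are no late slots,
    -- and `η = 0` is allowed.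
    have hηpos : 0 < η := by
      refine (hα.pos hk'.2).trans_le ?_
      rw [← hq k ⟨by omega, hk'.2⟩]
      exact measureReal_mono fun ω hω => le_trans hω (hx.below_le k hk'.1 hk'.2)
    rw [prod_rpow_mul_w hm hα hηpos hk'.1 hk'.2, Finset.sum_mul]
    exact (ofReal_sum_le _ _).trans (Finset.sum_le_sum fun p hp => htag k hk p hp)
  set J := (Finset.Icc j m ×ˢ Finset.range j) ×ˢ (Finset.univ : Finset (Fin n)) with hJ
  set E : (ℕ × ℕ) × Fin n → Set Ω := fun z => taggedEvent m τ j x X T z.1.1 z.1.2 z.2 with hE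
  have hJk : ∀ z ∈ J, j ≤ z.1.1 ∧ z.1.1 ≤ m := fun z hz => by
    simp only [hJ, Finset.mem_product, Finset.mem_Icc] at hz
    exact hz.1.1
  have hEdisj : Set.PairwiseDisjoint (↑J) E := by
    intro z hz z' hz' hne
    refine Set.disjoint_left.2 fun ω h1 h2 => hne ?_
    have a1 := hJk z hz
    have a2 := hJk z' hz'
    obtain ⟨e1, e2, e3⟩ := taggedEvent_index_unique hm hx (by omega) (by omega) h1 h2
    exact Prod.ext (Prod.ext e1 e2) e3
  have hEm : ∀ z ∈ J, MeasurableSet (E z) := fun z _ => h.measurableSet_taggedEvent _ _ _ _ _ _ _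
  have hsum : ∑ k ∈ Finset.Icc j m, ∑ p ∈ Finset.range j, ∑ i,
      μ (taggedEvent m τ j x X T k p i) = μ (⋃ z ∈ J, E z) := by
    rw [measure_biUnion_finset hEdisj hEm, hJ, Finset.sum_product, Finset.sum_product]
  have hdisj : Disjoint (earlyEvent m τ j X T) (⋃ z ∈ J, E z) := by
    rw [Set.disjoint_iUnion₂_right]
    exact fun z hz => disjoint_earlyEvent_taggedEvent hm hj (hJk z hz).1 z.2
  have hsub : earlyEvent m τ j X T ∪ (⋃ z ∈ J, E z) ⊆ {ω | x < reward m τ X T ω} := by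
    rintro ω (hω | hω)
    · exact lt_reward_of_mem_earlyEvent hx hω
    · obtain ⟨z, hz, hω⟩ := Set.mem_iUnion₂.1 hω
      exact lt_reward_of_mem_taggedEvent hm hx (hJk z hz).1 (hJk z hz).2 hω
  calc _ ≤ ENNReal.ofReal (1 / (m : ℝ) * ∑ k ∈ Finset.Ico 1 j, (1 - α k)) +
        ENNReal.ofReal (∑ k ∈ Finset.Icc j m,
          (∏ ν ∈ Finset.Ico 1 k, α ν) ^ (1 / (m : ℝ)) * w m α j η k * q m α η k) :=
        ENNReal.ofReal_add_le
    _ ≤ μ (earlyEvent m τ j X T) + ∑ k ∈ Finset.Icc j m, ∑ p ∈ Finset.range j, ∑ i,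
        μ (taggedEvent m τ j x X T k p i) := by
        refine add_le_add ?_ ((ofReal_sum_le _ _).trans (Finset.sum_le_sum hk))
        rw [ENNReal.ofReal_le_iff_le_toReal (measure_ne_top _ _)]
        exact h.le_real_earlyEvent hn hm hq hx
    _ = μ (earlyEvent m τ j X T ∪ (⋃ z ∈ J, E z)) := by
        rw [hsum, measure_union hdisj (Finset.measurableSet_biUnion _ hEm)]
    _ ≤ _ := measure_mono hsub

end Tail

/-! ### Existence and order of the thresholds -/

section Thresholds

variable {Ω : Type*} [MeasurableSpace Ω] {μ : Measure Ω} {n : ℕ} {X T : Fin n → Ω → ℝ}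

theorem IsInstance.quantile_nonneg (h : IsInstance μ X T) (hn : 0 < n) {m : ℕ} {α τ : ℕ → ℝ}
    (hα : Admissible m α) (hq : IsQuantiles μ X m α τ) {i : ℕ} (hi : i ∈ Set.Icc 1 m) :
    0 ≤ τ i := by
  by_contra hcon
  have h1 : μ {ω | prophet X ω ≤ τ i} = 0 := by
    rw [measure_eq_zero_iff_ae_notMem]
    filter_upwards [h.prophet_nonneg hn] with ω hω hle
    exact hcon (le_trans hω hle)
  have h2 := hq i hi
  rw [Measure.real, h1] at h2
  have := hα.pos hi.2
  simp at h2
  linarith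

variable [IsProbabilityMeasure μ]

/-- The distribution function of an atomless law on the line is continuous. -/
theorem continuous_cdf_of_noAtoms (ν : Measure ℝ) [IsProbabilityMeasure ν]
    (hν : ∀ x, ν {x} = 0) : Continuous (cdf ν) := by
  refine continuous_iff_continuousAt.2 fun x => ?_
  refine continuousAt_iff_continuous_left'_right'.2
    ⟨?_, ((cdf ν).right_continuous x).mono Set.Ioi_subset_Ici_self⟩
  rw [(monotone_cdf ν).continuousWithinAt_Iio_iff_leftLim_eq]
  have h1 := StieltjesFunction.measure_singleton (cdf ν) x
  rw [measure_cdf, hν x] at h1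
  have h2 := ENNReal.ofReal_eq_zero.1 h1.symm
  exact le_antisymm ((monotone_cdf ν).leftLim_le le_rfl) (by linarith)

/-- The maximum always equals one of the `X i`, so its law has no atoms either; its distribution
function is continuous and takes every value strictly between `0` and `1`. -/
theorem IsInstance.exists_quantile (h : IsInstance μ X T) (hn : 0 < n) {a : ℝ} (h0 : 0 < a)
    (h1 : a < 1) : ∃ y, μ.real {ω | prophet X ω ≤ y} = a := by
  have hZ := h.measurable_prophet hn
  have : IsProbabilityMeasure (μ.map (prophet X)) :=
    Measure.isProbabilityMeasure_map hZ.aemeasurable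
  have hcdf : ∀ y, cdf (μ.map (prophet X)) y = μ.real {ω | prophet X ω ≤ y} := fun y => by
    rw [cdf_eq_real, map_measureReal_apply hZ measurableSet_Iic]
    rfl
  have hna : ∀ y, μ.map (prophet X) {y} = 0 := by
    intro y
    rw [Measure.map_apply hZ (measurableSet_singleton y)]
    have : Nonempty (Fin n) := ⟨⟨0, hn⟩⟩
    refine measure_mono_null (t := ⋃ i, {ω | X i ω = y}) (fun ω hω => ?_)
      (measure_iUnion_null fun i => h.value_continuous i y)
    obtain ⟨i, hi⟩ := exists_eq_ciSup_of_finite (f := fun i => X i ω)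
    exact Set.mem_iUnion.2 ⟨i, hi.trans hω⟩
  have hc := continuous_cdf_of_noAtoms _ hna
  obtain ⟨y, hy⟩ := mem_range_of_exists_le_of_exists_ge hc
    (((tendsto_cdf_atBot (μ.map (prophet X))).eventually (gt_mem_nhds h0)).exists.imp
      fun _ h => le_of_lt h)
    (((tendsto_cdf_atTop (μ.map (prophet X))).eventually (lt_mem_nhds h1)).exists.imp
      fun _ h => le_of_lt h)
  exact ⟨y, by rw [← hcdf, hy]⟩

theorem IsInstance.exists_isQuantiles (h : IsInstance μ X T) (hn : 0 < n) {m : ℕ} {α : ℕ → ℝ}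
    (hα : Admissible m α) : ∃ τ, IsQuantiles μ X m α τ := by
  have : ∀ i, ∃ y, i ∈ Set.Icc 1 m → μ.real {ω | prophet X ω ≤ y} = α i := by
    intro i
    by_cases hi : i ∈ Set.Icc 1 m
    · obtain ⟨y, hy⟩ := h.exists_quantile hn (hα.pos hi.2)
        (by rw [← hα.1]; exact hα.strictAnti (by exact hi.1) (by have := hi.2; omega))
      exact ⟨y, fun _ => hy⟩
    · exact ⟨0, fun h => absurd h hi⟩
  choose τ hτ using this
  exact ⟨τ, hτ⟩

theorem IsQuantiles.strictAntiOn {m : ℕ} {α τ : ℕ → ℝ} (hα : Admissible m α)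
    (hq : IsQuantiles μ X m α τ) : StrictAntiOn τ (Set.Icc 1 m) := by
  intro i hi k hk hik
  by_contra hcon
  have h1 : μ.real {ω | prophet X ω ≤ τ i} ≤ μ.real {ω | prophet X ω ≤ τ k} :=
    measureReal_mono fun ω hω => le_trans hω (not_lt.1 hcon)
  rw [hq i hi, hq k hk] at h1
  have := hα.strictAnti hik (by have := hk.2; omega)
  linarith

end Thresholds

/-! ### From tails to the competitive ratio -/

theorem exists_between {m : ℕ} {τ : ℕ → ℝ} (hτ : StrictAntiOn τ (Set.Icc 1 m)) (x : ℝ) :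
    ∃ j, Between m τ j x := by
  classical
  have hanti : ∀ i k, 1 ≤ i → i ≤ k → k ≤ m → τ k ≤ τ i := fun i k h1 h2 h3 =>
    hτ.antitoneOn ⟨h1, h2.trans h3⟩ ⟨h1.trans h2, h3⟩ h2
  -- The index sought is the least such `j`; `m + 1` qualifies vacuously, covering levels below
  -- every threshold.
  have hex : ∃ j, 1 ≤ j ∧ (j ≤ m → τ j ≤ x) := ⟨m + 1, by omega, fun h => by omega⟩
  have hspec := Nat.find_spec hex
  have hmin : ∀ p, 1 ≤ p → p < Nat.find hex → p ≤ m ∧ x < τ p := fun p h1 h2 => by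
    have := Nat.find_min hex h2
    push Not at this
    exact this h1
  have hle : Nat.find hex ≤ m + 1 := Nat.find_min' hex ⟨by omega, fun h => by omega⟩
  refine ⟨Nat.find hex, hspec.1, hle, hanti, fun p h1 h2 => (hmin p h1 h2).2, fun k h1 h2 => ?_⟩
  exact (hanti _ _ hspec.1 h1 h2).trans (hspec.2 (h1.trans h2))

theorem w_nonneg {m : ℕ} {α : ℕ → ℝ} (hα : Admissible m α) {j : ℕ} {η : ℝ} (hη : 0 < η)
    (hηle : η ≤ α (j - 1)) {k : ℕ} (hjk : j ≤ k) (hkm : k ≤ m) : 0 ≤ w m α j η k := by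
  refine Finset.sum_nonneg fun ν hν => ?_
  rw [Finset.mem_range] at hν
  have hkm' : (k : ℝ) ≤ m := by exact_mod_cast hkm
  have hM : (0 : ℝ) < (m : ℝ) - ((k : ℝ) - 1) + ν := by
    have : (0 : ℝ) ≤ ν := Nat.cast_nonneg ν
    linarith
  have hr : 0 ≤ r m α j η k ν := by
    refine mul_nonneg (div_nonneg hM.le (Nat.cast_nonneg m)) (Real.log_nonneg ?_)
    rw [one_le_div (alphaHat_pos hα (by omega) hη _)]
    unfold alphaHat
    rw [if_pos hν]
    split_ifs with h
    · exact hα.anti (Nat.le_succ ν) (by omega)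
    · rwa [show ν = j - 1 by omega]
  refine mul_nonneg (mul_nonneg (Real.exp_pos _).le ?_) (by positivity)
  have := Real.exp_le_one_iff.2 (neg_nonpos.2 hr)
  linarith

theorem f_nonneg {m : ℕ} {α : ℕ → ℝ} (hα : Admissible m α) {j : ℕ} (hj : j ∈ Set.Icc 1 (m + 1))
    {η : ℝ} (hη : η ∈ Set.Icc (α j) (α (j - 1))) : 0 ≤ f m α j η := by
  obtain ⟨hj1, hjm⟩ := hj
  refine add_nonneg (mul_nonneg (by positivity) (Finset.sum_nonneg fun k hk => ?_))
    (Finset.sum_nonneg fun k hk => ?_)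
  · rw [Finset.mem_Ico] at hk
    linarith [hα.le_one (k := k) (by omega)]
  · rw [Finset.mem_Icc] at hk
    refine mul_nonneg (mul_nonneg (Real.rpow_nonneg (Finset.prod_nonneg fun ν hν => ?_) _) ?_)
      (poissonInv_nonneg _)
    · rw [Finset.mem_Ico] at hν
      exact (hα.pos (by omega)).le
    · exact w_nonneg hα ((hα.pos (by omega)).trans_le hη.1) hη.2 hk.1 hk.2

theorem bddBelow_ratios {m : ℕ} {α : ℕ → ℝ} (hα : Admissible m α) :
    BddBelow {x | ∃ j ∈ Set.Icc 1 (m + 1), ∃ η ∈ Set.Icc (α j) (α (j - 1)),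
      η ≠ 1 ∧ x = f m α j η / (1 - η)} := by
  refine ⟨0, ?_⟩
  rintro _ ⟨j, hj, η, hη, -, rfl⟩
  refine div_nonneg (f_nonneg hα hj hη) ?_
  have := hα.le_one (k := j - 1) (by have := hj.2; omega)
  linarith [hη.2]

/-- The point `η = 1` is absent from the infimum, but there the claim only says that `f` is
non-negative. -/
theorem ratioBound_mul_le {m : ℕ} {α : ℕ → ℝ} (hα : Admissible m α) {j : ℕ}
    (hj : j ∈ Set.Icc 1 (m + 1)) {η : ℝ} (hη : η ∈ Set.Icc (α j) (α (j - 1))) :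
    ratioBound m α * (1 - η) ≤ f m α j η := by
  have h1 : η ≤ 1 := hη.2.trans (hα.le_one (by have := hj.2; omega))
  rcases h1.eq_or_lt with h2 | h2
  · rw [h2, sub_self, mul_zero, ← h2]
    exact f_nonneg hα hj hη
  · rw [← le_div_iff₀ (by linarith)]
    exact csInf_le (bddBelow_ratios hα) ⟨j, hj, η, hη, h2.ne, rfl⟩

/-- Layer-cake formula on both sides; the integrands are then compared level by level. -/
theorem isCompetitive_of_le_ratioBound {m : ℕ} (hm : 1 ≤ m) {α : ℕ → ℝ}
    (hα : Admissible m α) {c : ℝ} (hc : c ≤ ratioBound m α) : IsCompetitive.{u} m α c := by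
  intro n hn Ω _ μ _ X T h τ hq
  rw [lintegral_eq_lintegral_meas_lt μ (h.prophet_nonneg hn)
      (h.measurable_prophet hn).aemeasurable,
    lintegral_eq_lintegral_meas_lt μ (h.reward_nonneg m τ)
      (h.measurable_reward m τ).aemeasurable,
    ← lintegral_const_mul' _ _ ENNReal.ofReal_ne_top]
  refine lintegral_mono fun x => ?_
  obtain ⟨j, hj⟩ := exists_between (IsQuantiles.strictAntiOn hα hq) x
  refine le_trans ?_ (h.ofReal_f_le_measure_lt_reward hn hm hα hq hj)
  set η := μ.real {ω | prophet X ω ≤ x} with hη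
  have hZ : μ {ω | x < prophet X ω} = ENNReal.ofReal (1 - η) := by
    rw [hη, ← probReal_compl_eq_one_sub (s := {ω | prophet X ω ≤ x})
      ((h.measurable_prophet hn) measurableSet_Iic), ofReal_measureReal]
    congr 1
    ext ω
    simp
  have hη1 : η ≤ 1 := measureReal_le_one
  rw [hZ, ← ENNReal.ofReal_mul' (by linarith)]
  refine ENNReal.ofReal_le_ofReal ((mul_le_mul_of_nonneg_right hc (by linarith)).trans
    (ratioBound_mul_le hα ⟨hj.one_le, hj.le_succ⟩ ⟨?_, ?_⟩))
  · rcases hj.le_succ.eq_or_lt with h1 | h1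
    · rw [h1, hα.2.1]
      exact measureReal_nonneg
    · rw [← hq j ⟨hj.one_le, by omega⟩]
      exact measureReal_mono fun ω hω => le_trans hω (hj.below_le j le_rfl (by omega))
  · rcases hj.one_le.eq_or_lt with h1 | h1
    · rw [← h1, Nat.sub_self, hα.1]
      exact hη1
    · have := hj.le_succ
      rw [← hq (j - 1) ⟨by omega, by omega⟩]
      exact measureReal_mono fun ω hω =>
        le_trans hω (hj.lt_above (j - 1) (by omega) (by omega)).le

/-! ### Lower bounds for `f_j` suited to computation -/

theorem q_eq_of_lt {m : ℕ} (hm : 1 ≤ m) {α : ℕ → ℝ} {k : ℕ} {η : ℝ} (hk : 0 < α k)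
    (hη : α k < η) :
    q m α η k = (1 - (α k / η) ^ (1 / (m : ℝ))) / (1 / (m : ℝ) * Real.log (η / α k)) := by
  have hm' : (0 : ℝ) < m := by exact_mod_cast hm
  have hη0 : 0 < η := hk.trans hη
  have hlog : 0 < Real.log (η / α k) := Real.log_pos (by rwa [one_lt_div hk])
  rw [q_eq_poissonInv, poissonInv_of_ne_zero (by positivity),
    Real.rpow_def_of_pos (by positivity)]
  congr 3
  rw [Real.log_div hη0.ne' hk.ne', Real.log_div hk.ne' hη0.ne']
  ring

/-- In the last level the weight loses at most `(η - α_j) / m` when `η` moves up from `α_j`. -/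
theorem prod_rpow_mul_w_ge {m : ℕ} (hm : 0 < m) {α : ℕ → ℝ} (hα : Admissible m α) {j : ℕ}
    (hj : 1 ≤ j) {η : ℝ} (hη : α j ≤ η) {k : ℕ} (hjk : j ≤ k) (hkm : k ≤ m) :
    (∏ ν ∈ Finset.Ico 1 k, α ν) ^ (1 / (m : ℝ)) * w m α j (α j) k - 1 / (m : ℝ) * (η - α j) ≤
      (∏ ν ∈ Finset.Ico 1 k, α ν) ^ (1 / (m : ℝ)) * w m α j η k := by
  have hm' : (0 : ℝ) < m := by exact_mod_cast hm
  have hαj : 0 < α j := hα.pos (hjk.trans hkm)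
  rw [prod_rpow_mul_w hm hα hαj hjk hkm, prod_rpow_mul_w hm hα (hαj.trans_le hη) hjk hkm]
  obtain ⟨i, rfl⟩ : ∃ i, j = i + 1 := ⟨j - 1, by omega⟩
  rw [Finset.sum_range_succ, Finset.sum_range_succ]
  -- Only the last level, `p = i = j - 1`, involves `η`; all the others agree on both sides.
  have hrest : ∀ p ∈ Finset.range i, ∀ ζ, alphaHat α (i + 1) ζ p = α p ∧
      alphaHat α (i + 1) ζ (p + 1) = α (p + 1) := by
    intro p hp ζ
    rw [Finset.mem_range] at hp
    simp only [alphaHat]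
    exact ⟨if_pos (by omega), if_pos (by omega)⟩
  have hsum := Finset.sum_congr rfl (s₁ := Finset.range i) (f := fun p : ℕ =>
      1 / ((m : ℝ) - ((k : ℝ) - 1) + p) *
        (alphaHat α (i + 1) (α (i + 1)) p ^ (((m : ℝ) - ((k : ℝ) - 1) + p) / m) -
          alphaHat α (i + 1) (α (i + 1)) (p + 1) ^ (((m : ℝ) - ((k : ℝ) - 1) + p) / m)) *
        Real.exp (1 / (m : ℝ) * ∑ ν ∈ Finset.Ioo p k, Real.log (α ν)))
    (g := fun p : ℕ => 1 / ((m : ℝ) - ((k : ℝ) - 1) + p) *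
        (alphaHat α (i + 1) η p ^ (((m : ℝ) - ((k : ℝ) - 1) + p) / m) -
          alphaHat α (i + 1) η (p + 1) ^ (((m : ℝ) - ((k : ℝ) - 1) + p) / m)) *
        Real.exp (1 / (m : ℝ) * ∑ ν ∈ Finset.Ioo p k, Real.log (α ν))) (fun p hp => by
      rw [(hrest p hp _).1, (hrest p hp _).2, (hrest p hp _).1, (hrest p hp _).2])
  rw [hsum]
  have h1 : ∀ ζ, alphaHat α (i + 1) ζ i = α i := fun ζ => if_pos (by omega)
  have h2 : ∀ ζ, alphaHat α (i + 1) ζ (i + 1) = ζ := fun ζ => if_neg (by omega)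
  rw [h1, h2, h1, h2]
  set c := ((m : ℝ) - ((k : ℝ) - 1) + i) / m with hc
  have hM : (m : ℝ) - ((k : ℝ) - 1) + i = m * c := by
    rw [hc]
    field_simp
  have hkm' : (k : ℝ) ≤ m := by exact_mod_cast hkm
  have hik' : (i : ℝ) + 1 ≤ k := by exact_mod_cast hjk
  have hc0 : 0 < c := by
    have : (0 : ℝ) ≤ i := Nat.cast_nonneg i
    exact div_pos (by linarith) hm'
  have hc1 : c ≤ 1 := by
    rw [hc, div_le_one hm']
    linarith
  set E := Real.exp (1 / (m : ℝ) * ∑ ν ∈ Finset.Ioo i k, Real.log (α ν)) with hE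
  -- The `k - 1 - i` logarithms are each at most `log α_{i+1}`, and `(k - 1 - i) / m = 1 - c`.
  have hED : E ≤ α (i + 1) ^ (1 - c) := by
    rw [Real.rpow_def_of_pos hαj, hE]
    refine Real.exp_le_exp.2 ?_
    have e1 : ∑ ν ∈ Finset.Ioo i k, Real.log (α ν) ≤
        (Finset.Ioo i k).card * Real.log (α (i + 1)) := by
      rw [← nsmul_eq_mul]
      refine Finset.sum_le_card_nsmul _ _ _ fun ν hν => ?_
      rw [Finset.mem_Ioo] at hν
      exact Real.log_le_log (hα.pos (by omega)) (hα.anti (by omega) (by omega))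
    have e2 : ((Finset.Ioo i k).card : ℝ) = m * (1 - c) := by
      rw [Nat.card_Ioo, Nat.cast_sub (by omega), Nat.cast_sub (by omega), mul_sub, ← hM]
      push_cast
      ring
    rw [e2] at e1
    have e3 := mul_le_mul_of_nonneg_left e1 (by positivity : (0 : ℝ) ≤ 1 / (m : ℝ))
    refine e3.trans (le_of_eq ?_)
    field_simp
  have key := mul_rpow_sub_rpow_le hαj hη hc0 hc1 hED
  have key2 := mul_le_mul_of_nonneg_left key (by positivity : (0 : ℝ) ≤ 1 / (m : ℝ))
  clear_value c
  rw [hM]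
  have e4 : 1 / (m : ℝ) * (E * (1 / c * (η ^ c - α (i + 1) ^ c))) =
      1 / (m * c) * (α i ^ c - α (i + 1) ^ c) * E - 1 / (m * c) * (α i ^ c - η ^ c) * E := by
    field_simp
    ring
  linarith

/-- For `j = 1` the weights are bounded by a multiple of `1 - η`. -/
theorem prod_rpow_mul_w_one_ge {m : ℕ} (hm : 0 < m) {α : ℕ → ℝ} (hα : Admissible m α)
    {η : ℝ} (hη : 0 < η) {k : ℕ} (hk : 1 ≤ k) (hkm : k ≤ m) :
    1 / (m : ℝ) * (1 - η) * Real.exp (1 / (m : ℝ) * ∑ ν ∈ Finset.Ioo 0 k, Real.log (α ν)) ≤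
      (∏ ν ∈ Finset.Ico 1 k, α ν) ^ (1 / (m : ℝ)) * w m α 1 η k := by
  have hm' : (0 : ℝ) < m := by exact_mod_cast hm
  have hkm' : (k : ℝ) ≤ m := by exact_mod_cast hkm
  have hk' : (1 : ℝ) ≤ k := by exact_mod_cast hk
  rw [prod_rpow_mul_w hm hα hη hk hkm, Finset.sum_range_one]
  refine mul_le_mul_of_nonneg_right ?_ (Real.exp_pos _).le
  have h1 : alphaHat α 1 η 0 = 1 := by simp [alphaHat, hα.1]
  have h2 : alphaHat α 1 η (0 + 1) = η := by simp [alphaHat]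
  rw [h1, h2, Real.one_rpow, Nat.cast_zero, add_zero]
  have hM : 0 < (m : ℝ) - ((k : ℝ) - 1) := by linarith
  -- Bernoulli: `η ^ c ≤ 1 - c * (1 - η)` with `c = (m - (k - 1)) / m`; the factor `c` turns the
  -- prefactor into `1 / m`.
  have h3 := rpow_one_add_le_one_add_mul_self (s := η - 1)
    (p := ((m : ℝ) - ((k : ℝ) - 1)) / m) (by linarith) (by positivity)
    (by rw [div_le_one hm']; linarith)
  rw [add_sub_cancel] at h3
  calc 1 / (m : ℝ) * (1 - η) = 1 / ((m : ℝ) - ((k : ℝ) - 1)) *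
        (((m : ℝ) - ((k : ℝ) - 1)) / m * (1 - η)) := by field_simp
    _ ≤ _ := mul_le_mul_of_nonneg_left (by linarith) (by positivity)

theorem q_nonneg (m : ℕ) (α : ℕ → ℝ) (η : ℝ) (k : ℕ) : 0 ≤ q m α η k := poissonInv_nonneg _

theorem q_le_one {m : ℕ} {α : ℕ → ℝ} {η : ℝ} {k : ℕ} (hk : 0 < α k) (hη : α k ≤ η) :
    q m α η k ≤ 1 :=
  poissonInv_le_one (mul_nonneg (by positivity)
    (Real.log_nonneg (by rwa [one_le_div hk])))

theorem q_anti {m : ℕ} {α : ℕ → ℝ} {η η' : ℝ} {k : ℕ} (hk : 0 < α k) (hη : 0 < η)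
    (h : η ≤ η') : q m α η' k ≤ q m α η k :=
  poissonInv_antitone (mul_le_mul_of_nonneg_left (Real.log_le_log (by positivity)
    (div_le_div_of_nonneg_right h hk.le)) (by positivity))

/-- The Poisson parameter grows by `(1/m) log (η / a) ≤ (η - a) / (m * a)`, so `q` shrinks at most
by the exponential of that, which is at least `1` minus it. -/
theorem mul_q_le_q {m : ℕ} {α : ℕ → ℝ} {a η : ℝ} {k : ℕ} (hk : 0 < α k)
    (ha : 0 < a) (h : a ≤ η) : (1 - (η - a) / (m * a)) * q m α a k ≤ q m α η k := by
  have hη : 0 < η := ha.trans_le h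
  have hle : 1 / (m : ℝ) * Real.log (a / α k) ≤ 1 / (m : ℝ) * Real.log (η / α k) :=
    mul_le_mul_of_nonneg_left (Real.log_le_log (by positivity)
      (div_le_div_of_nonneg_right h hk.le)) (by positivity)
  refine le_trans (mul_le_mul_of_nonneg_right ?_ (q_nonneg m α a k))
    (exp_neg_mul_poissonInv_le hle)
  have h1 := Real.add_one_le_exp (-(1 / (m : ℝ) * Real.log (η / α k) -
    1 / (m : ℝ) * Real.log (a / α k)))
  refine le_trans ?_ h1
  rw [Real.log_div hη.ne' hk.ne', Real.log_div ha.ne' hk.ne']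
  have h2 := Real.log_le_sub_one_of_pos (div_pos hη ha)
  rw [Real.log_div hη.ne' ha.ne'] at h2
  have h3 := mul_le_mul_of_nonneg_left h2 (by positivity : (0 : ℝ) ≤ 1 / (m : ℝ))
  have h4 : 1 / (m : ℝ) * (η / a - 1) = (η - a) / (m * a) := by
    rw [mul_comm (m : ℝ) a, ← div_div, sub_div, div_self ha.ne']
    ring
  linarith

/-- A lower bound for `f_j` that is affine in `η`, from its value at the left end `α_j`. -/
theorem f_ge_affine {m : ℕ} (hm : 0 < m) {α : ℕ → ℝ} (hα : Admissible m α) {j : ℕ} (hj : 1 ≤ j)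
    (hjm : j ≤ m) {η L : ℝ} (hη : α j ≤ η) (hη1 : η ≤ α (j - 1))
    (hε : (η - α j) / (m * α j) ≤ 1)
    (hL : L ≤ ∑ k ∈ Finset.Icc j m,
      (∏ ν ∈ Finset.Ico 1 k, α ν) ^ (1 / (m : ℝ)) * w m α j (α j) k * q m α (α j) k) :
    1 / (m : ℝ) * ∑ k ∈ Finset.Ico 1 j, (1 - α k) + (1 - (η - α j) / (m * α j)) * L -
      ((m : ℝ) + 1 - j) / m * (η - α j) ≤ f m α j η := by
  have hm' : (0 : ℝ) < m := by exact_mod_cast hm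
  have hαj : 0 < α j := hα.pos hjm
  set ε := (η - α j) / (m * α j) with hεdef
  have hε0 : 0 ≤ ε := div_nonneg (by linarith) (by positivity)
  set V : ℕ → ℝ := fun k => (∏ ν ∈ Finset.Ico 1 k, α ν) ^ (1 / (m : ℝ)) * w m α j (α j) k with hV
  have hterm : ∀ k ∈ Finset.Icc j m,
      (1 - ε) * (V k * q m α (α j) k) - 1 / (m : ℝ) * (η - α j) ≤
      (∏ ν ∈ Finset.Ico 1 k, α ν) ^ (1 / (m : ℝ)) * w m α j η k * q m α η k := by
    intro k hk
    rw [Finset.mem_Icc] at hk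
    have hαk : 0 < α k := hα.pos hk.2
    have hprod : 0 ≤ (∏ ν ∈ Finset.Ico 1 k, α ν) ^ (1 / (m : ℝ)) :=
      Real.rpow_nonneg (Finset.prod_nonneg fun ν hν => by
        rw [Finset.mem_Ico] at hν
        exact (hα.pos (by omega)).le) _
    have hW := mul_nonneg hprod (w_nonneg hα (hαj.trans_le hη) hη1 hk.1 hk.2)
    have h1 := prod_rpow_mul_w_ge hm hα hj hη hk.1 hk.2
    have h2 := mul_q_le_q (m := m) hαk hαj hη
    have h3 := mul_le_mul_of_nonneg_left h2 hW
    have hq0 := q_nonneg m α (α j) k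
    have hq1 : q m α (α j) k ≤ 1 := q_le_one hαk (hα.anti hk.1 (by omega))
    have h4 : 0 ≤ (1 - ε) * q m α (α j) k := mul_nonneg (by linarith) hq0
    have h5 := mul_le_mul_of_nonneg_right h1 h4
    -- This caps the loss in each slot at `(η - α_j) / m`; there are `m + 1 - j` slots from `j` to
    -- `m`.
    have h6 : (1 - ε) * q m α (α j) k ≤ 1 := by nlinarith
    have h7 := mul_le_mul_of_nonneg_left h6
      (mul_nonneg (by positivity : (0 : ℝ) ≤ 1 / (m : ℝ)) (sub_nonneg.2 hη))
    have h8 : (V k - 1 / (m : ℝ) * (η - α j)) * ((1 - ε) * q m α (α j) k) =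
        (1 - ε) * (V k * q m α (α j) k) -
          1 / (m : ℝ) * (η - α j) * ((1 - ε) * q m α (α j) k) := by ring
    linarith
  have hsum := Finset.sum_le_sum hterm
  rw [Finset.sum_sub_distrib, ← Finset.mul_sum, Finset.sum_const, Nat.card_Icc, nsmul_eq_mul,
    Nat.cast_sub (by omega)] at hsum
  have h9 := mul_le_mul_of_nonneg_left hL (sub_nonneg.2 hε)
  have h10 : (((m + 1 : ℕ) : ℝ) - j) * (1 / (m : ℝ) * (η - α j)) =
      ((m : ℝ) + 1 - j) / m * (η - α j) := by
    push_cast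
    ring
  unfold f
  linarith

/-- The value of the weight at the left end, in terms of the roots `β_ν` of the `α_ν`. -/
theorem prod_rpow_mul_w_left {m : ℕ} (hm : 0 < m) {α β : ℕ → ℝ} (hα : Admissible m α)
    (hβ : ∀ ν ≤ m, 0 < β ν) (hαβ : ∀ ν ≤ m, α ν = β ν ^ m) {j k : ℕ} (hjk : j ≤ k)
    (hkm : k ≤ m) :
    (∏ ν ∈ Finset.Ico 1 k, α ν) ^ (1 / (m : ℝ)) * w m α j (α j) k =
      ∑ p ∈ Finset.range j, 1 / ((m + 1 + p - k : ℕ) : ℝ) *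
        (β p ^ (m + 1 + p - k) - β (p + 1) ^ (m + 1 + p - k)) * ∏ ν ∈ Finset.Ioo p k, β ν := by
  have hm' : (m : ℝ) ≠ 0 := by positivity
  rw [prod_rpow_mul_w hm hα (hα.pos (hjk.trans hkm)) hjk hkm]
  refine Finset.sum_congr rfl fun p hp => ?_
  rw [Finset.mem_range] at hp
  have hM : (m : ℝ) - ((k : ℝ) - 1) + p = ((m + 1 + p - k : ℕ) : ℝ) := by
    rw [Nat.cast_sub (by omega)]
    push_cast
    ring
  have hat : ∀ ν ≤ j, alphaHat α j (α j) ν = α ν := by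
    intro ν hν
    unfold alphaHat
    split_ifs with h
    · rfl
    · rw [show ν = j by omega]
  have hpow : ∀ ν ≤ m, ∀ M : ℕ, α ν ^ ((M : ℝ) / m) = β ν ^ M := by
    intro ν hν M
    rw [hαβ ν hν, ← Real.rpow_natCast (β ν) m, ← Real.rpow_mul (hβ ν hν).le,
      mul_div_cancel₀ _ hm', Real.rpow_natCast]
  have hexp : Real.exp (1 / (m : ℝ) * ∑ ν ∈ Finset.Ioo p k, Real.log (α ν)) =
      ∏ ν ∈ Finset.Ioo p k, β ν := by
    rw [Finset.mul_sum, Real.exp_sum]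
    refine Finset.prod_congr rfl fun ν hν => ?_
    rw [Finset.mem_Ioo] at hν
    rw [hαβ ν (by omega), Real.log_pow, one_div, inv_mul_cancel_left₀ hm',
      Real.exp_log (hβ ν (by omega))]
  rw [hM, hat p (by omega), hat (p + 1) (by omega), hpow p (by omega),
    hpow (p + 1) (by omega), hexp]

/-- The constant `1/100 = 6 / (5! * 5)` comes from the remainder estimate `Real.exp_bound`, not from
the Taylor coefficient. -/
theorem quintic_le_exp_neg {y : ℝ} (h0 : 0 ≤ y) (h1 : y ≤ 1) :
    1 - y + y ^ 2 / 2 - y ^ 3 / 6 + y ^ 4 / 24 - y ^ 5 / 100 ≤ Real.exp (-y) := by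
  have h := Real.exp_bound (x := -y) (n := 5) (by rw [abs_neg, abs_of_nonneg h0]; exact h1)
    (by norm_num)
  rw [abs_neg, abs_of_nonneg h0] at h
  have h2 := (abs_le.1 h).1
  simp only [Finset.sum_range_succ, Finset.sum_range_zero, Nat.factorial] at h2
  norm_num at h2
  nlinarith

/-- Integrate the quintic bound over `v`, after discarding its last two terms, whose sum is
non-negative for `0 ≤ y ≤ 1`. -/
theorem cubic_le_poissonInv {x : ℝ} (h0 : 0 ≤ x) (h1 : x ≤ 1) :
    1 - x / 2 + x ^ 2 / 6 - x ^ 3 / 24 ≤ poissonInv x := by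
  rw [poissonInv_eq_integral]
  have hint : ∫ v in (0 : ℝ)..1, (1 - x * v + x ^ 2 / 2 * v ^ 2 - x ^ 3 / 6 * v ^ 3) =
      1 - x / 2 + x ^ 2 / 6 - x ^ 3 / 24 := by
    rw [intervalIntegral.integral_sub, intervalIntegral.integral_add,
      intervalIntegral.integral_sub, intervalIntegral.integral_const_mul,
      intervalIntegral.integral_const_mul, intervalIntegral.integral_const_mul, integral_id,
      integral_pow, integral_pow]
    · norm_num
      ring
    all_goals exact Continuous.intervalIntegrable (by fun_prop) _ _
  rw [← hint]
  refine intervalIntegral.integral_mono_on (by norm_num)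
    (Continuous.intervalIntegrable (by fun_prop) _ _)
    (Continuous.intervalIntegrable (by fun_prop) _ _) fun v hv => ?_
  have hy0 : 0 ≤ x * v := mul_nonneg h0 hv.1
  have hy1 : x * v ≤ 1 := mul_le_one₀ h1 hv.1 hv.2
  have h2 := quintic_le_exp_neg hy0 hy1
  have h3 : (x * v) ^ 5 ≤ (x * v) ^ 4 := pow_le_pow_of_le_one hy0 hy1 (by norm_num)
  have h4 : 0 ≤ (x * v) ^ 4 := by positivity
  have h5 : 1 - x * v + x ^ 2 / 2 * v ^ 2 - x ^ 3 / 6 * v ^ 3 =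
      1 - x * v + (x * v) ^ 2 / 2 - (x * v) ^ 3 / 6 := by ring
  linarith

/-! ### Rational data for the 16 thresholds and exact checks -/

section Numerics

/-- The values of `alpha16` as rational numbers. -/
def alphaRat (i : ℕ) : ℚ :=
  [1, 0.66758603836404173, 0.62053145929311715, 0.57324846512425975,
    0.52577742556626594, 0.47816906417879007, 0.43049233470891257,
    0.38283722646593055, 0.33533950489086961, 0.28831226925828957,
    0.23273108361807243, 0.19315610994691487, 0.16547915613363387,
    0.13558301500280728, 0.10412501367635961, 0.071479537771643828,
    0.036291830527618585, 0].getD i 0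

/-- Lower bounds for the 16th roots of the `alphaRat i`, `i ≤ 16`. -/
def rootLo (i : ℕ) : ℚ :=
  [1, 0.975060813, 0.970616651, 0.965820526, 0.960616674, 0.954935068, 0.948686758, 0.941755976,
    0.933991222, 0.925212401, 0.912910914, 0.902338064, 0.893658223, 0.882597779, 0.868154842,
    0.847981462, 0.812808159].getD i 0

/-- Upper bounds for the 16th roots of the `alphaRat i`, `i ≤ 16`. -/
def rootHi (i : ℕ) : ℚ := if i = 0 then 1 else rootLo i + 0.000000001

/-- Lower bounds for the negative logarithms of the 16th roots. -/
def logLo (i : ℕ) : ℚ :=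
  [0, 0.02525543, 0.02982368, 0.03477725, 0.04017983, 0.04611193, 0.05267660, 0.06000908,
    0.06828823, 0.07773193, 0.09111696, 0.10276601, 0.11243184, 0.12488563, 0.14138506,
    0.16489623, 0.20725924].getD i 0

/-- Upper bounds for the negative logarithms of the 16th roots. -/
def logHi (i : ℕ) : ℚ :=
  [0, 0.02525544, 0.02982369, 0.03477726, 0.04017984, 0.04611194, 0.05267662, 0.06000909,
    0.06828824, 0.07773195, 0.09111698, 0.10276604, 0.11243189, 0.12488571, 0.14138521,
    0.16489653, 0.20726026].getD i 0

/-- The cubic lower bound for `poissonInv`. -/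
def invLo (x : ℚ) : ℚ := 1 - x / 2 + x ^ 2 / 6 - x ^ 3 / 24

/-- Lower bound for the contribution of the level `p` to the weight of the slot `k`. -/
def levelLo (k p : ℕ) : ℚ :=
  1 / ((17 + p - k : ℕ) : ℚ) * (rootLo p ^ (17 + p - k) - rootHi (p + 1) ^ (17 + p - k)) *
    ∏ ν ∈ Finset.Ioo p k, rootLo ν

/-- Lower bound for the contribution of the slots from `j` on, at `η = α_j`. -/
def lateLo (j : ℕ) : ℚ :=
  ∑ k ∈ Finset.Icc j 16, (∑ p ∈ Finset.range j, levelLo k p) * invLo (logHi k - logLo j)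

theorem alphaRat_succ_lt : ∀ i ∈ Finset.range 17, alphaRat (i + 1) < alphaRat i := by
  decide +kernel

theorem root_bounds : ∀ i ∈ Finset.range 17, 0 < rootLo i ∧ rootLo i ^ 16 ≤ alphaRat i ∧
    alphaRat i ≤ rootHi i ^ 16 ∧ 0 ≤ rootHi i := by
  decide +kernel

theorem rootHi_succ_le : ∀ i ∈ Finset.range 16, rootHi (i + 1) ≤ rootLo i := by
  decide +kernel

/-- The last two conditions certify the logarithms: `1 ≤ rootLo * exp logHi` through a partial sum
of the exponential series, and `rootHi ≤ exp (-logLo)` through the quintic bound. -/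
theorem log_bounds : ∀ i ∈ Finset.range 17, 0 ≤ logLo i ∧ logLo i ≤ 1 ∧ 0 ≤ logHi i ∧
    logHi i ≤ 1 ∧
    1 ≤ rootLo i * ∑ l ∈ Finset.range 6, logHi i ^ l / (l.factorial : ℚ) ∧
    rootHi i ≤ 1 - logLo i + logLo i ^ 2 / 2 - logLo i ^ 3 / 6 + logLo i ^ 4 / 24 -
      logLo i ^ 5 / 100 := by
  decide +kernel

/-- The affine lower bound for `f_j` is tested at `η = α_j` and at `η = α_{j-1}`; the third
condition keeps the factor `1 - ε` of `f_ge_affine` non-negative. -/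
theorem lateLo_bounds : ∀ j ∈ Finset.Icc 2 16,
    0.6724 * (1 - alphaRat j) ≤
      1 / 16 * ∑ k ∈ Finset.Ico 1 j, (1 - alphaRat k) + lateLo j ∧
    0.6724 * (1 - alphaRat (j - 1)) ≤
      1 / 16 * ∑ k ∈ Finset.Ico 1 j, (1 - alphaRat k) +
        (1 - (alphaRat (j - 1) - alphaRat j) / (16 * alphaRat j)) * lateLo j -
        (17 - (j : ℚ)) / 16 * (alphaRat (j - 1) - alphaRat j) ∧
    (alphaRat (j - 1) - alphaRat j) / (16 * alphaRat j) ≤ 1 := by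
  decide +kernel

/-- The case `j = 1` with the common factor `1 - η` removed and `q` taken at its smallest, `η = 1`.
-/
theorem firstLo_bound : 0.6724 ≤
    ∑ k ∈ Finset.Icc 1 16, 1 / 16 * (∏ ν ∈ Finset.Ioo 0 k, rootLo ν) * invLo (logHi k) := by
  decide +kernel

theorem lastLo_bound : 0.6724 ≤ 1 / 16 * ∑ k ∈ Finset.Ico 1 17, (1 - alphaRat k) := by
  decide +kernel

end Numerics

/-! ### The bound `0.6724` for the explicit quantiles -/

section SixteenThresholds

theorem alpha16_eq (i : ℕ) : alpha16 i = (alphaRat i : ℝ) := by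
  rcases lt_or_ge i 18 with h | h
  · interval_cases i <;> norm_num [alpha16, alphaRat]
  · unfold alpha16 alphaRat
    rw [List.getD_eq_default _ _ (by simpa using h), List.getD_eq_default _ _ (by simpa using h)]
    simp

theorem admissible_alpha16 : Admissible 16 alpha16 := by
  refine ⟨by simp [alpha16], by simp [alpha16], fun i hi => ?_⟩
  rw [alpha16_eq, alpha16_eq]
  exact_mod_cast alphaRat_succ_lt i (by simp; omega)

/-- The 16th roots of the values `alpha16 i`. -/
def root (i : ℕ) : ℝ := alpha16 i ^ (1 / (16 : ℝ))

theorem root_pos {i : ℕ} (hi : i ≤ 16) : 0 < root i :=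
  Real.rpow_pos_of_pos (admissible_alpha16.pos hi) _

theorem alpha16_eq_root_pow {i : ℕ} (hi : i ≤ 16) : alpha16 i = root i ^ 16 := by
  rw [root, ← Real.rpow_natCast, ← Real.rpow_mul (admissible_alpha16.pos hi).le]
  norm_num

theorem rootLo_pos {i : ℕ} (hi : i ≤ 16) : (0 : ℝ) < rootLo i := by
  exact_mod_cast (root_bounds i (by simp; omega)).1

theorem rootLo_le_root {i : ℕ} (hi : i ≤ 16) : (rootLo i : ℝ) ≤ root i := by
  have h := (root_bounds i (by simp; omega)).2.1
  refine le_of_pow_le_pow_left₀ (by norm_num : 16 ≠ 0) (root_pos hi).le ?_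
  rw [← alpha16_eq_root_pow hi, alpha16_eq]
  exact_mod_cast h

theorem root_le_rootHi {i : ℕ} (hi : i ≤ 16) : root i ≤ rootHi i := by
  have h := (root_bounds i (by simp; omega)).2.2
  refine le_of_pow_le_pow_left₀ (by norm_num : 16 ≠ 0) (by exact_mod_cast h.2) ?_
  rw [← alpha16_eq_root_pow hi, alpha16_eq]
  exact_mod_cast h.1

theorem neg_log_root_le {i : ℕ} (hi : i ≤ 16) : -Real.log (root i) ≤ logHi i := by
  obtain ⟨-, -, h0, -, h1, -⟩ := log_bounds i (by simp; omega)
  have h0' : (0 : ℝ) ≤ logHi i := by exact_mod_cast h0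
  have h1' : (1 : ℝ) ≤ rootLo i * ∑ l ∈ Finset.range 6, (logHi i : ℝ) ^ l / (l.factorial : ℝ) := by
    exact_mod_cast h1
  have h2 : (1 : ℝ) ≤ root i * Real.exp (logHi i) :=
    h1'.trans (mul_le_mul (rootLo_le_root hi) (Real.sum_le_exp_of_nonneg h0' 6)
      (Finset.sum_nonneg fun l _ => by positivity) (root_pos hi).le)
  have h3 := Real.log_le_log one_pos h2
  rw [Real.log_one, Real.log_mul (root_pos hi).ne' (Real.exp_ne_zero _), Real.log_exp] at h3
  linarith

theorem le_neg_log_root {i : ℕ} (hi : i ≤ 16) : logLo i ≤ -Real.log (root i) := by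
  obtain ⟨h0, h1, -, -, -, h2⟩ := log_bounds i (by simp; omega)
  have h2' : (rootHi i : ℝ) ≤ 1 - logLo i + (logLo i : ℝ) ^ 2 / 2 - (logLo i : ℝ) ^ 3 / 6 +
      (logLo i : ℝ) ^ 4 / 24 - (logLo i : ℝ) ^ 5 / 100 := by
    exact_mod_cast h2
  have h3 := (root_le_rootHi hi).trans (h2'.trans
    (quintic_le_exp_neg (by exact_mod_cast h0) (by exact_mod_cast h1)))
  have h4 := Real.log_le_log (root_pos hi) h3
  rw [Real.log_exp] at h4
  linarith

/-- In terms of 16th roots the Poisson parameter is a difference of two negative logarithms. As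
`poissonInv` decreases, an upper bound for the parameter is what is needed: `logHi` at `k` and
`logLo` at `j`. -/
theorem invLo_le_q {j k : ℕ} (hjk : j ≤ k) (hk : k ≤ 16) :
    (invLo (logHi k - logLo j) : ℝ) ≤ q 16 alpha16 (alpha16 j) k := by
  have hjp : 0 < alpha16 j := admissible_alpha16.pos (hjk.trans hk)
  have hkp : 0 < alpha16 k := admissible_alpha16.pos hk
  set y : ℝ := logHi k - logLo j with hy
  have hlog : 1 / ((16 : ℕ) : ℝ) * Real.log (alpha16 j / alpha16 k) =
      -Real.log (root k) - -Real.log (root j) := by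
    rw [Real.log_div hjp.ne' hkp.ne', alpha16_eq_root_pow hk, alpha16_eq_root_pow (hjk.trans hk),
      Real.log_pow, Real.log_pow]
    push_cast
    ring
  have hle : 1 / ((16 : ℕ) : ℝ) * Real.log (alpha16 j / alpha16 k) ≤ y := by
    rw [hlog]
    linarith [neg_log_root_le hk, le_neg_log_root (hjk.trans hk)]
  have h0 : 0 ≤ y := by
    refine le_trans (mul_nonneg (by positivity) (Real.log_nonneg ?_)) hle
    rw [one_le_div hkp]
    exact admissible_alpha16.anti hjk (by omega)
  have h1 : y ≤ 1 := by
    have e1 : (logHi k : ℝ) ≤ 1 := by exact_mod_cast (log_bounds k (by simp; omega)).2.2.2.1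
    have e2 : (0 : ℝ) ≤ logLo j := by exact_mod_cast (log_bounds j (by simp; omega)).1
    linarith
  have h2 := (cubic_le_poissonInv h0 h1).trans (poissonInv_antitone hle)
  rw [q_eq_poissonInv]
  refine le_trans (le_of_eq ?_) h2
  rw [hy]
  unfold invLo
  push_cast
  ring

theorem levelLo_nonneg {k p : ℕ} (hp : p < k) (hk : k ≤ 16) : (0 : ℝ) ≤ levelLo k p := by
  unfold levelLo
  push_cast
  refine mul_nonneg (mul_nonneg (by positivity) (sub_nonneg.2 ?_))
    (Finset.prod_nonneg fun ν hν => (rootLo_pos ?_).le)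
  · refine pow_le_pow_left₀ ?_ ?_ _
    · exact_mod_cast (root_bounds (p + 1) (by simp; omega)).2.2.2
    · exact_mod_cast rootHi_succ_le p (by simp; omega)
  · rw [Finset.mem_Ioo] at hν
    omega

theorem levelLo_le {k p : ℕ} (hp : p < k) (hk : k ≤ 16) :
    (levelLo k p : ℝ) ≤ 1 / ((16 + 1 + p - k : ℕ) : ℝ) *
      (root p ^ (16 + 1 + p - k) - root (p + 1) ^ (16 + 1 + p - k)) *
        ∏ ν ∈ Finset.Ioo p k, root ν := by
  unfold levelLo
  push_cast
  have h1 : (rootLo p : ℝ) ^ (17 + p - k) ≤ root p ^ (17 + p - k) :=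
    pow_le_pow_left₀ (rootLo_pos (by omega)).le (rootLo_le_root (by omega)) _
  have h2 : root (p + 1) ^ (17 + p - k) ≤ (rootHi (p + 1) : ℝ) ^ (17 + p - k) :=
    pow_le_pow_left₀ (root_pos (by omega)).le (root_le_rootHi (by omega)) _
  have h3 : root (p + 1) ^ (17 + p - k) ≤ root p ^ (17 + p - k) := by
    refine h2.trans (le_trans (pow_le_pow_left₀ ?_ ?_ _) h1)
    · exact_mod_cast (root_bounds (p + 1) (by simp; omega)).2.2.2
    · exact_mod_cast rootHi_succ_le p (by simp; omega)
  refine mul_le_mul (mul_le_mul_of_nonneg_left (by linarith) (by positivity))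
    (Finset.prod_le_prod (fun ν hν => ?_) fun ν hν => ?_) (Finset.prod_nonneg fun ν hν => ?_)
    (mul_nonneg (by positivity) (by linarith))
  all_goals rw [Finset.mem_Ioo] at hν
  · exact (rootLo_pos (by omega)).le
  · exact rootLo_le_root (by omega)
  · exact (rootLo_pos (by omega)).le

theorem lateLo_le {j : ℕ} :
    (lateLo j : ℝ) ≤ ∑ k ∈ Finset.Icc j 16,
      (∏ ν ∈ Finset.Ico 1 k, alpha16 ν) ^ (1 / ((16 : ℕ) : ℝ)) * w 16 alpha16 j (alpha16 j) k *
        q 16 alpha16 (alpha16 j) k := by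
  unfold lateLo
  rw [Rat.cast_sum]
  refine Finset.sum_le_sum fun k hk => ?_
  rw [Finset.mem_Icc] at hk
  rw [Rat.cast_mul, Rat.cast_sum,
    prod_rpow_mul_w_left (by norm_num) admissible_alpha16 (fun ν hν => root_pos hν) (fun ν hν => alpha16_eq_root_pow hν) hk.1 hk.2]
  have h1 : ∑ p ∈ Finset.range j, (levelLo k p : ℝ) ≤ _ :=
    Finset.sum_le_sum fun p hp => levelLo_le (by rw [Finset.mem_range] at hp; omega) hk.2
  have h0 : 0 ≤ ∑ p ∈ Finset.range j, (levelLo k p : ℝ) :=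
    Finset.sum_nonneg fun p hp => levelLo_nonneg (by rw [Finset.mem_range] at hp; omega) hk.2
  exact (mul_le_mul_of_nonneg_left (invLo_le_q hk.1 hk.2) h0).trans
    (mul_le_mul_of_nonneg_right h1 (q_nonneg _ _ _ _))

/-- The case `j = 1`. -/
theorem f_one_ge {η : ℝ} (h0 : 0 < η) (h1 : η ≤ 1) : 0.6724 * (1 - η) ≤ f 16 alpha16 1 η := by
  have hle : ∀ k ∈ Finset.Icc 1 16,
      (1 / 16 * (∏ ν ∈ Finset.Ioo 0 k, (rootLo ν : ℝ)) * invLo (logHi k)) * (1 - η) ≤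
      (∏ ν ∈ Finset.Ico 1 k, alpha16 ν) ^ (1 / ((16 : ℕ) : ℝ)) * w 16 alpha16 1 η k *
        q 16 alpha16 η k := by
    intro k hk
    rw [Finset.mem_Icc] at hk
    have e1 := prod_rpow_mul_w_one_ge (by norm_num) admissible_alpha16 h0 hk.1 hk.2
    have e2 : ∏ ν ∈ Finset.Ioo 0 k, (rootLo ν : ℝ) ≤ Real.exp (1 / ((16 : ℕ) : ℝ) *
        ∑ ν ∈ Finset.Ioo 0 k, Real.log (alpha16 ν)) := by
      rw [Finset.mul_sum, Real.exp_sum]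
      refine Finset.prod_le_prod (fun ν hν => ?_) fun ν hν => ?_
      all_goals rw [Finset.mem_Ioo] at hν
      · exact (rootLo_pos (by omega)).le
      · rw [alpha16_eq_root_pow (by omega), Real.log_pow, one_div,
          inv_mul_cancel_left₀ (by norm_num), Real.exp_log (root_pos (by omega))]
        exact rootLo_le_root (by omega)
    have e3 : (invLo (logHi k) : ℝ) ≤ q 16 alpha16 η k := by
      -- Taking `j = 0` gives `q` at `η = α 0 = 1`, its minimum over `η ≤ 1`.
      have h2 := invLo_le_q (Nat.zero_le k) hk.2
      have h3 : logLo 0 = 0 := rfl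
      rw [h3, sub_zero, admissible_alpha16.1] at h2
      exact h2.trans (q_anti (admissible_alpha16.pos hk.2) h0 h1)
    have p0 : 0 ≤ ∏ ν ∈ Finset.Ioo 0 k, (rootLo ν : ℝ) := Finset.prod_nonneg fun ν hν => by
      rw [Finset.mem_Ioo] at hν
      exact (rootLo_pos (by omega)).le
    have hη : 0 ≤ 1 - η := by linarith
    have e4 : 1 / ((16 : ℕ) : ℝ) * (1 - η) * ∏ ν ∈ Finset.Ioo 0 k, (rootLo ν : ℝ) ≤
        (∏ ν ∈ Finset.Ico 1 k, alpha16 ν) ^ (1 / ((16 : ℕ) : ℝ)) * w 16 alpha16 1 η k :=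
      (mul_le_mul_of_nonneg_left e2 (by positivity)).trans e1
    calc _ = 1 / ((16 : ℕ) : ℝ) * (1 - η) * (∏ ν ∈ Finset.Ioo 0 k, (rootLo ν : ℝ)) *
          invLo (logHi k) := by
          push_cast
          ring
      _ ≤ 1 / ((16 : ℕ) : ℝ) * (1 - η) * (∏ ν ∈ Finset.Ioo 0 k, (rootLo ν : ℝ)) *
          q 16 alpha16 η k := mul_le_mul_of_nonneg_left e3 (by positivity)
      _ ≤ _ := mul_le_mul_of_nonneg_right e4 (q_nonneg _ _ _ _)
  have hsum := Finset.sum_le_sum hle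
  rw [← Finset.sum_mul] at hsum
  have hb : (0.6724 : ℝ) ≤ ∑ k ∈ Finset.Icc 1 16,
      1 / 16 * (∏ ν ∈ Finset.Ioo 0 k, (rootLo ν : ℝ)) * invLo (logHi k) := by
    have h := (Rat.cast_le (K := ℝ)).2 firstLo_bound
    push_cast at h
    exact h
  have h2 := mul_le_mul_of_nonneg_right hb (by linarith : 0 ≤ 1 - η)
  unfold f
  rw [Finset.Ico_self, Finset.sum_empty, mul_zero, zero_add]
  exact h2.trans hsum

theorem f_alpha16_ge {j : ℕ} (hj : j ∈ Set.Icc 1 17) {η : ℝ}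
    (hη : η ∈ Set.Icc (alpha16 j) (alpha16 (j - 1))) :
    0.6724 * (1 - η) ≤ f 16 alpha16 j η := by
  obtain ⟨hj1, hj17⟩ := hj
  obtain ⟨hη0, hη1⟩ := hη
  rcases hj1.eq_or_lt with rfl | hj2
  · refine f_one_ge ((admissible_alpha16.pos (by norm_num)).trans_le hη0) ?_
    rwa [Nat.sub_self, admissible_alpha16.1] at hη1
  rcases hj17.eq_or_lt with rfl | hj16
  · have h := (Rat.cast_le (K := ℝ)).2 lastLo_bound
    push_cast at h
    simp_rw [← alpha16_eq] at h
    have h0 : 0 ≤ η := by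
      rw [admissible_alpha16.2.1] at hη0
      exact hη0
    unfold f
    rw [Finset.Icc_eq_empty (by norm_num), Finset.sum_empty, add_zero]
    push_cast
    linarith
  · obtain ⟨b1, b2, b3⟩ := lateLo_bounds j (by simp; omega)
    have hαj : 0 < alpha16 j := admissible_alpha16.pos (by omega)
    have b1' := (Rat.cast_le (K := ℝ)).2 b1
    have b2' := (Rat.cast_le (K := ℝ)).2 b2
    have b3' := (Rat.cast_le (K := ℝ)).2 b3
    push_cast at b1' b2' b3'
    simp only [← alpha16_eq] at b1' b2' b3'
    have hε : (η - alpha16 j) / ((16 : ℕ) * alpha16 j) ≤ 1 := by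
      refine le_trans ?_ b3'
      push_cast
      exact div_le_div_of_nonneg_right (by linarith) (by positivity)
    refine le_trans ?_ (f_ge_affine (by norm_num) admissible_alpha16 hj1 (by omega) hη0 hη1 hε
      lateLo_le)
    push_cast
    set a := alpha16 j
    set b := alpha16 (j - 1)
    set F : ℝ := 1 / 16 * ∑ k ∈ Finset.Ico 1 j, (1 - alpha16 k)
    set L : ℝ := (lateLo j : ℝ)
    have hab : a < b := by
      have := admissible_alpha16.strictAnti (i := j - 1) (k := j) (by omega) (by omega)
      exact this
    -- Write `η` as a convex combination of the two endpoints; both sides are affine in `η`, so the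
    -- endpoint inequalities combine with weights `1 - θ` and `θ`.
    obtain ⟨θ, hθ0, hθ1, hθ⟩ : ∃ θ : ℝ, 0 ≤ θ ∧ θ ≤ 1 ∧ η - a = θ * (b - a) :=
      ⟨(η - a) / (b - a), div_nonneg (by linarith) (by linarith),
        (div_le_one (by linarith)).2 (by linarith),
        (div_mul_cancel₀ _ (by linarith)).symm⟩
    have hη' : η = a + θ * (b - a) := by linarith
    have c1 := mul_le_mul_of_nonneg_left b1' (by linarith : 0 ≤ 1 - θ)
    have c2 := mul_le_mul_of_nonneg_left b2' hθ0
    rw [hθ, hη', mul_div_assoc]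
    set δ := (b - a) / (16 * a)
    linarith

theorem le_ratioBound_alpha16 : 0.6724 ≤ ratioBound 16 alpha16 := by
  refine le_csInf ?_ ?_
  -- The infimum must range over a non-empty set of ratios; `j = 17` with `η = 0` supplies one.
  · refine ⟨_, 17, ⟨by norm_num, by norm_num⟩, alpha16 17,
      ⟨le_rfl, admissible_alpha16.anti (by norm_num) le_rfl⟩, ?_, rfl⟩
    rw [admissible_alpha16.2.1]
    norm_num
  · rintro _ ⟨j, hj, η, hη, hne, rfl⟩
    have h1 : η ≤ 1 := hη.2.trans (admissible_alpha16.le_one (by have := hj.2; omega))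
    rw [le_div_iff₀ (by linarith [lt_of_le_of_ne h1 hne])]
    exact f_alpha16_ge hj hη

end SixteenThresholds

end ProphetSecretary

end

theorem mainTheorem7 :
    -- the strategy is well defined: on every instance thresholds with the prescribed quantiles
    -- exist, and they are non-negative and strictly decreasing
    (∀ (m : ℕ) (α : ℕ → ℝ), 1 ≤ m → ProphetSecretary.Admissible m α →
      ∀ (n : ℕ), 0 < n → ∀ (Ω : Type u) [MeasurableSpace Ω] (μ : Measure Ω)
        [IsProbabilityMeasure μ] (X T : Fin n → Ω → ℝ), ProphetSecretary.IsInstance μ X T →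
        (∃ τ : ℕ → ℝ, ProphetSecretary.IsQuantiles μ X m α τ) ∧
        ∀ τ : ℕ → ℝ, ProphetSecretary.IsQuantiles μ X m α τ →
          StrictAntiOn τ (Set.Icc 1 m) ∧ ∀ i ∈ Set.Icc 1 m, 0 ≤ τ i) ∧
    -- the general lower bound on the competitive ratio
    (∀ (m : ℕ) (α : ℕ → ℝ), 1 ≤ m → ProphetSecretary.Admissible m α →
      ProphetSecretary.IsCompetitive.{u} m α (ProphetSecretary.ratioBound m α)) ∧
    -- the closed form of `q`
    (∀ (m : ℕ) (α : ℕ → ℝ), 1 ≤ m → ProphetSecretary.Admissible m α →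
      ∀ k ∈ Set.Icc 1 m, ∀ η : ℝ, α k < η → η ≤ 1 →
        ProphetSecretary.q m α η k =
          (1 - (α k / η) ^ (1 / (m : ℝ))) / (1 / (m : ℝ) * Real.log (η / α k))) ∧
    -- the explicit strategy with 16 thresholds
    (ProphetSecretary.Admissible 16 ProphetSecretary.alpha16 ∧ 0.6724 ≤ ProphetSecretary.ratioBound 16 ProphetSecretary.alpha16 ∧
      ProphetSecretary.IsCompetitive.{u} 16 ProphetSecretary.alpha16 0.6724) := by
  refine ⟨?_, ?_, ?_, ProphetSecretary.admissible_alpha16,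
    ProphetSecretary.le_ratioBound_alpha16, ?_⟩
  · intro m α _ hα n hn Ω _ μ _ X T h
    exact ⟨h.exists_isQuantiles hn hα, fun τ hq =>
      ⟨ProphetSecretary.IsQuantiles.strictAntiOn hα hq,
        fun i hi => h.quantile_nonneg hn hα hq hi⟩⟩
  · intro m α hm hα
    exact ProphetSecretary.isCompetitive_of_le_ratioBound hm hα le_rfl
  · intro m α hm hα k hk η hη _
    exact ProphetSecretary.q_eq_of_lt hm (hα.pos hk.2) hη
  · exact ProphetSecretary.isCompetitive_of_le_ratioBound (by norm_num)
      ProphetSecretary.admissible_alpha16 ProphetSecretary.le_ratioBound_alpha16
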